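/- Let $c>0$, $s_0>1$, $0<\delta<1$. In $\mathbb R^{1+3}$ write $r=|x|$, $s=\sqrt{t^2-r^2}$, $m=\mathrm{diag}(-1,1,1,1)$, $\mathcal H_{s}=\{t>0,\ t^2-r^2=s^2\}$, $\mathcal J=\{t>0,\ t^2-r^2\ge s_0^2\}$ (the future of $\mathcal H_{s_0}$) and $\mathcal K=\{r\le t-1\}$. Let $g^{\alpha\beta}=m^{\alpha\beta}-h^{\alpha\beta}$ with $h^{\alpha\beta}=h^{\beta\alpha}$ of class $C^1$ at each point of $\mathcal J$, and let $v$, of class $C^2$ at each point of $\mathcal J$, satisfy in $\mathcal J$ $$-\widetilde\Box_g v+c^2v=f,\qquad \widetilde\Box_g:=g^{\alpha\beta}\partial_\alpha\partial_\beta,\qquad v|_{\mathcal H_{s_0}}=v_0,\quad \partial_tv|_{\mathcal H_{s_0}}=v_1,$$ with $v_0,v_1$ supported in the compact set $\mathcal H_{s_0}\cap\mathcal K$. Let $\overline\partial_0=\frac st\partial_t$, $\overline\partial_a=\partial_a+\frac{x^a}t\partial_t$ be the frame of the coordinates $(\overline x^0,\overline x^a)=(s,x^a)$, let $\overline\Psi{}^\alpha_\beta=\partial_\beta\overline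 x^\alpha$ and $\overline h^{\alpha\beta}=\overline\Psi{}^\alpha_\mu\overline\Psi{}^\beta_\nu h^{\mu\nu}$, and assume that $|\overline h^{00}|\le\delta$ in $\mathcal J$. Assume also that, in $\mathcal J\setminus\mathcal K$, either $h$ vanishes identically or $v$ vanishes identically. Put $\partial_\perp=\partial_t+\frac{x^a}t\partial_a$, $h_{t,x}(\lambda)=\overline h^{00}(\lambda t/s,\lambda x/s)$, $S(r/t)=\sqrt{\frac{t+r}{t-r}}$ and $F=F_{t,x}$, $$F(\tau)=\int_{s_0}^{\tau}\big|R_1+R_2+R_3+s^{3/2}f\big|(\lambda t/s,\lambda x/s)\,d\lambda ,$$ where (Latin indices run over $1,2,3$, Greek ones over $0,\dots,3$) $$R_1=s^{3/2}\Big(\sum_a\overline\partial_a\overline\partial_av+\tfrac{x^ax^b}{s^2}\overline\partial_a\overline\partial_bv+\tfrac{3}{4s^2}v+\tfrac{3x^a}{s^2}\overline\partial_av\Big),$$ $$R_2=\overline h^{00}\big(\tfrac{3}{4s^{1/2}}v+3s^{1/2}\overline\partial_0v\big)-s^{3/2}\big(2\overline h^{0b}\overline\partial_0\overline\partial_bv+\overline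 h^{ab}\overline\partial_a\overline\partial_bv+h^{\alpha\beta}\partial_\alpha(\overline\Psi{}^\gamma_\beta)\overline\partial_\gamma v\big),$$ $$R_3=\overline h^{00}\big(2x^as^{1/2}\overline\partial_0\overline\partial_av+\tfrac{3x^a}{s^{1/2}}\overline\partial_av+\tfrac{x^ax^b}{s^{1/2}}\overline\partial_a\overline\partial_bv\big).$$ For $C,D\ge0$ define, if $0\le r/t\le\frac{s_0^2-1}{1+s_0^2}$, $$V_{C,D}(t,x)=D\Big(1+\int_{s_0}^s|h'_{t,x}(\bar s)|e^{C\int_{\bar s}^s|h'_{t,x}(\lambda)|d\lambda}d\bar s\Big)+F(s)+\int_{s_0}^sF(\bar s)|h'_{t,x}(\bar s)|e^{C\int_{\bar s}^s|h'_{t,x}(\lambda)|d\lambda}d\bar s,$$ and, if $\frac{s_0^2-1}{1+s_0^2}<r/t<1$, $$V_{C,D}(t,x)=F(s)+\int_{S(r/t)}^sF(\bar s)|h'_{t,x}(\bar s)|e^{C\int_{\bar s}^s|h'_{t,x}(\lambda)|d\lambda}d\bar s .$$ Then there are constants $C>0$ and $A>0$ depending only on $c,s_0,\delta$, and a constant $A'>0$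 depending only on $c,s_0,\delta$ and the data $v_0,v_1$, such that for all such $h,f,v$ and all $(t,x)\in\mathcal J$ $$s^{3/2}|v|+\tfrac ts\,s^{3/2}|\partial_\perp v|\le A'\,V_{C,D}(t,x)\quad\text{with } D=\|v_0\|_{L^\infty(\mathcal H_{s_0})}+\|v_1\|_{L^\infty(\mathcal H_{s_0})},$$ and the same left-hand side is at most $A\,V_{C,D'}(t,x)$ with $D'=D+\|\overline\partial v_0\|_{L^\infty(\mathcal H_{s_0})}$, where $\overline\partial v_0=(\overline\partial_1v_0,\overline\partial_2v_0,\overline\partial_3v_0)$ is the tangential gradient of $v_0$. -/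

import Mathlib

noncomputable section

namespace HypKG

/-- Euclidean three-space. -/
abbrev Space : Type := EuclideanSpace ℝ (Fin 3)

/-- Minkowski spacetime, with points `p = (t, x)`. -/
abbrev Spacetime : Type := ℝ × Space

/-- The Cartesian coordinates `x^0 = t, x^1, x^2, x^3` of a point. -/
def coord (α : Fin 4) (p : Spacetime) : ℝ :=
  Fin.cases p.1 (fun a => p.2 a) α

/-- The Cartesian coordinate vectors. -/
def basisVec (α : Fin 4) : Spacetime :=
  Fin.cases ((1, 0) : Spacetime) (fun a => ((0, EuclideanSpace.single a 1) : Spacetime)) α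

/-- The Cartesian partial derivative `∂_α u`. -/
def pd (α : Fin 4) (u : Spacetime → ℝ) (p : Spacetime) : ℝ :=
  fderiv ℝ u p (basisVec α)

/-- The hyperbolic radius `s = √(t² - |x|²)`. -/
def hypRadius (p : Spacetime) : ℝ :=
  Real.sqrt (p.1 ^ 2 - ‖p.2‖ ^ 2)

/-- The hyperboloid `H_s = {t > 0, t² - |x|² = s²}`. -/
def hyperboloid (s : ℝ) : Set Spacetime :=
  {p | 0 < p.1 ∧ p.1 ^ 2 - ‖p.2‖ ^ 2 = s ^ 2}

/-- The future of the hyperboloid `H_{s₀}` (hyperboloid included). -/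
def future (s₀ : ℝ) : Set Spacetime :=
  {p | 0 < p.1 ∧ s₀ ^ 2 ≤ p.1 ^ 2 - ‖p.2‖ ^ 2}

/-- The future light cone `K = {|x| ≤ t - 1}`. -/
def coneK : Set Spacetime :=
  {p | ‖p.2‖ ≤ p.1 - 1}

/-- The point of `H_{s}` above `x ∈ ℝ³`. -/
def hypPoint (s : ℝ) (x : Space) : Spacetime :=
  (Real.sqrt (s ^ 2 + ‖x‖ ^ 2), x)

/-- The Minkowski metric `m = diag(-1, 1, 1, 1)`. -/
def mink (α β : Fin 4) : ℝ :=
  if α = β then (if α = 0 then -1 else 1) else 0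

/-- The reduced wave operator `g^{αβ} ∂_α ∂_β v` of the metric `g^{αβ} = m^{αβ} - h^{αβ}`. -/
def reducedBox (h : Fin 4 → Fin 4 → Spacetime → ℝ) (v : Spacetime → ℝ) (p : Spacetime) : ℝ :=
  ∑ α, ∑ β, (mink α β - h α β p) * pd α (pd β v) p

/-- The vector field `∂_⊥ = ∂_t + (x^a / t) ∂_a`. -/
def perp (u : Spacetime → ℝ) (p : Spacetime) : ℝ :=
  pd 0 u p + ∑ a : Fin 3, p.2 a / p.1 * pd a.succ u p

/-! The hyperboloidal frame, that is, the coordinate frame of the coordinates `(s, x^1, x^2, x^3)`: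
`∂̄_0 = (s / t) ∂_t` and `∂̄_a = ∂_a + (x^a / t) ∂_t`. -/

/-- The hyperboloidal frame field `∂̄_α`. -/
def hypD (α : Fin 4) (u : Spacetime → ℝ) (p : Spacetime) : ℝ :=
  Fin.cases (hypRadius p / p.1 * pd 0 u p)
    (fun a => pd a.succ u p + p.2 a / p.1 * pd 0 u p) α

/-- The transition matrix `Ψ^α_β = ∂_β x̄^α`, where `x̄ = (s, x^1, x^2, x^3)`;
thus `∂_β = Ψ^α_β ∂̄_α`. -/
def Psi (α β : Fin 4) (p : Spacetime) : ℝ :=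
  Fin.cases
    (Fin.cases (p.1 / hypRadius p) (fun b => -(p.2 b) / hypRadius p) β)
    (fun a => if β = Fin.succ a then 1 else 0) α

/-- The components `h̄^{αβ} = Ψ^α_μ Ψ^β_ν h^{μν}` of `h` in the hyperboloidal frame. -/
def hbar (h : Fin 4 → Fin 4 → Spacetime → ℝ) (α β : Fin 4) (p : Spacetime) : ℝ :=
  ∑ μ, ∑ ν, Psi α μ p * Psi β ν p * h μ ν p

/-- The point `(λ t / s, λ x / s)` on the ray through the origin and `p = (t, x)`. -/
def ray (p : Spacetime) (l : ℝ) : Spacetime :=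
  (l * p.1 / hypRadius p, (l / hypRadius p) • p.2)

/-- The function `h_{t,x}(λ) = h̄^{00}(λ t / s, λ x / s)`. -/
def hRay (h : Fin 4 → Fin 4 → Spacetime → ℝ) (p : Spacetime) (l : ℝ) : ℝ :=
  hbar h 0 0 (ray p l)

/-- The derivative `h'_{t,x}(λ)`. -/
def hRay' (h : Fin 4 → Fin 4 → Spacetime → ℝ) (p : Spacetime) (l : ℝ) : ℝ :=
  deriv (hRay h p) l

/-- The flat remainder
`s^{3/2} (∑_a ∂̄_a ∂̄_a v + (x^a x^b / s²) ∂̄_a ∂̄_b v + 3 v / (4 s²) + (3 x^a / s²) ∂̄_a v)`. -/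
def R₁ (v : Spacetime → ℝ) (p : Spacetime) : ℝ :=
  hypRadius p ^ (3 / 2 : ℝ) *
    (∑ a : Fin 3, hypD a.succ (hypD a.succ v) p
      + ∑ a : Fin 3, ∑ b : Fin 3,
          p.2 a * p.2 b / hypRadius p ^ 2 * hypD a.succ (hypD b.succ v) p
      + 3 / (4 * hypRadius p ^ 2) * v p
      + ∑ a : Fin 3, 3 * p.2 a / hypRadius p ^ 2 * hypD a.succ v p)

/-- The curved remainder
`h̄^{00} (3 v / (4 s^{1/2}) + 3 s^{1/2} ∂̄_0 v)
 - s^{3/2} (2 h̄^{0b} ∂̄_0 ∂̄_b v + h̄^{ab} ∂̄_a ∂̄_b v + h^{αβ} ∂_α(Ψ^γ_β) ∂̄_γ v)`. -/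
def R₂ (h : Fin 4 → Fin 4 → Spacetime → ℝ) (v : Spacetime → ℝ) (p : Spacetime) : ℝ :=
  hbar h 0 0 p *
      (3 / (4 * hypRadius p ^ (1 / 2 : ℝ)) * v p
        + 3 * hypRadius p ^ (1 / 2 : ℝ) * hypD 0 v p)
    - hypRadius p ^ (3 / 2 : ℝ) *
      (∑ b : Fin 3, 2 * hbar h 0 b.succ p * hypD 0 (hypD b.succ v) p
        + ∑ a : Fin 3, ∑ b : Fin 3, hbar h a.succ b.succ p * hypD a.succ (hypD b.succ v) p
        + ∑ α, ∑ β, ∑ γ, h α β p * pd α (Psi γ β) p * hypD γ v p)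

/-- The curved remainder
`h̄^{00} (2 x^a s^{1/2} ∂̄_0 ∂̄_a v + (3 x^a / s^{1/2}) ∂̄_a v + (x^a x^b / s^{1/2}) ∂̄_a ∂̄_b v)`. -/
def R₃ (h : Fin 4 → Fin 4 → Spacetime → ℝ) (v : Spacetime → ℝ) (p : Spacetime) : ℝ :=
  hbar h 0 0 p *
    (∑ a : Fin 3, 2 * p.2 a * hypRadius p ^ (1 / 2 : ℝ) * hypD 0 (hypD a.succ v) p
      + ∑ a : Fin 3, 3 * p.2 a / hypRadius p ^ (1 / 2 : ℝ) * hypD a.succ v p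
      + ∑ a : Fin 3, ∑ b : Fin 3,
          p.2 a * p.2 b / hypRadius p ^ (1 / 2 : ℝ) * hypD a.succ (hypD b.succ v) p)

/-- The integrated source
`F(τ) = ∫_{s₀}^τ |R₁[v] + R₂[v] + R₃[v] + s^{3/2} f|(λ t / s, λ x / s) dλ` along the ray
through `p = (t, x)`. -/
def intSource (s₀ : ℝ) (h : Fin 4 → Fin 4 → Spacetime → ℝ) (f v : Spacetime → ℝ)
    (p : Spacetime) (τ : ℝ) : ℝ :=
  ∫ l in s₀..τ,
    |R₁ v (ray p l) + R₂ h v (ray p l) + R₃ h v (ray p l)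
      + hypRadius (ray p l) ^ (3 / 2 : ℝ) * f (ray p l)|

/-- The weight `|h'_{t,x}(σ)| exp(C ∫_σ^s |h'_{t,x}(λ)| dλ)`, where `s` is the hyperbolic
radius of `p = (t, x)`. -/
def rayWeight (C : ℝ) (h : Fin 4 → Fin 4 → Spacetime → ℝ) (p : Spacetime) (σ : ℝ) : ℝ :=
  |hRay' h p σ| * Real.exp (C * ∫ l in σ..hypRadius p, |hRay' h p l|)

/-- `S(r / t) = √((t + r) / (t - r))`, the hyperbolic radius at which the ray through `(t, x)`
meets the boundary of `K`. -/
def entryRadius (p : Spacetime) : ℝ :=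
  Real.sqrt ((p.1 + ‖p.2‖) / (p.1 - ‖p.2‖))

open Classical in
/-- The function `V`, where `D` is the size of the initial data: the first case is far from the
light cone, the second one is near the light cone. -/
def boundV (C s₀ D : ℝ) (h : Fin 4 → Fin 4 → Spacetime → ℝ) (f v : Spacetime → ℝ)
    (p : Spacetime) : ℝ :=
  if ‖p.2‖ / p.1 ≤ (s₀ ^ 2 - 1) / (1 + s₀ ^ 2) then
    D * (1 + ∫ σ in s₀..hypRadius p, rayWeight C h p σ)
      + intSource s₀ h f v p (hypRadius p)
      + ∫ σ in s₀..hypRadius p, intSource s₀ h f v p σ * rayWeight C h p σ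
  else
    intSource s₀ h f v p (hypRadius p)
      + ∫ σ in entryRadius p..hypRadius p, intSource s₀ h f v p σ * rayWeight C h p σ

/-- The sup norm of a function on `H_{s₀}`, parametrized by `x ∈ ℝ³`. -/
def supNorm (w : Space → ℝ) : ℝ :=
  ⨆ x, |w x|

/-- The sup norm on `H_{s₀}` of the tangential derivatives `(∂̄_1 w, ∂̄_2 w, ∂̄_3 w)` of a function
`w` on `H_{s₀}`, parametrized by `x ∈ ℝ³`. -/
def supNormGrad (w : Space → ℝ) : ℝ :=
  ⨆ x, ‖fderiv ℝ w x‖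

/-- `v` is a classical solution, in the future of `H_{s₀}`, of `-g^{αβ} ∂_α ∂_β v + c² v = f`
with `g^{αβ} = m^{αβ} - h^{αβ}`, `v = v₀` and `∂_t v = v₁` on `H_{s₀}`, where the data are
supported in the compact set `H_{s₀} ∩ K`. -/
structure IsKGSolution (c s₀ : ℝ) (h : Fin 4 → Fin 4 → Spacetime → ℝ) (f : Spacetime → ℝ)
    (v₀ v₁ : Space → ℝ) (v : Spacetime → ℝ) : Prop where
  metric_symm : ∀ p ∈ future s₀, ∀ α β, h α β p = h β α p
  metric_smooth : ∀ p ∈ future s₀, ∀ α β, ContDiffAt ℝ 1 (h α β) p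
  sol_smooth : ∀ p ∈ future s₀, ContDiffAt ℝ 2 v p
  equation : ∀ p ∈ future s₀, -reducedBox h v p + c ^ 2 * v p = f p
  data_zero : ∀ x, v (hypPoint s₀ x) = v₀ x
  data_one : ∀ x, pd 0 v (hypPoint s₀ x) = v₁ x
  data_supp : ∀ x, hypPoint s₀ x ∉ coneK → v₀ x = 0 ∧ v₁ x = 0

end HypKG

end

/-! ### Gronwall's inequality and the energy estimate for the ordinary differential equation. -/

section

open Set Filter Topology MeasureTheory

/-! The estimate is proved on one ray through the origin at a time. Put `w(λ) = λ^{3/2} v(λt/s,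
λx/s)`. The flat operator in the hyperboloidal frame contains the damping term `(3/s) ∂̄_0`, and the
exponent `3/2` is the one that absorbs it. The Klein-Gordon equation thus becomes an oscillator
equation `(1 + η) w'' + c² w = G`, where `η` is `h̄^{00}` on the ray and `G = R₁ + R₂ + R₃ + s^{3/2}
f` collects everything else (`ray_equation`, `deriv_deriv_rayW`).

The energy `E = w'² + c² w² / (1 + η)` is differentiated: the terms in `w w'` cancel and only `G`
and `η'` remain, so `√E` obeys a linear differential inequality and Gronwall applies
(`sqrt_energy_le`). Since `s^{3/2} (t/s) ∂_⊥ v` is `w'` minus a multiple of `s^{1/2} v`, the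
left-hand side of the theorem is controlled by `√E`.

Two facts about the cone `K` shape the bound. If `r/t` exceeds the threshold, the ray starts outside
`K`, where the data vanish, so the initial energy is zero. Until the ray enters `K`, at `S(r/t)`,
either `h' = 0` or `F = 0`, so the last integral may start there (`boundV_eq`). Otherwise the
initial energy is bounded by the data; the tangential gradient of `v₀` enters because the ray is not
parallel to `∂_t`. Removing that gradient costs the ratio of the two data norms, hence a constant
that depends on the data. -/

theorem hasDerivAt_primitive_of_mem_Ioo {g : ℝ → ℝ} {a b : ℝ} (hg : ContinuousOn g (Icc a b))
    {τ : ℝ} (hτ : τ ∈ Ioo a b) : HasDerivAt (fun x => ∫ l in a..x, g l) (g τ) τ := by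
  refine intervalIntegral.integral_hasDerivAt_right ?_ ?_ ?_
  · exact (hg.mono (by
      rw [uIcc_of_le hτ.1.le]
      exact Icc_subset_Icc_right hτ.2.le)).intervalIntegrable
  · exact (hg.mono Ioo_subset_Icc_self).stronglyMeasurableAtFilter isOpen_Ioo τ hτ
  · exact hg.continuousAt (Icc_mem_nhds hτ.1 hτ.2)

theorem continuousOn_primitive_of_continuousOn {g : ℝ → ℝ} {a b : ℝ} (hab : a ≤ b)
    (hg : ContinuousOn g (Icc a b)) : ContinuousOn (fun x => ∫ l in a..x, g l) (Icc a b) := by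
  have := intervalIntegral.continuousOn_primitive_interval (μ := volume) (f := g) (a := a) (b := b)
    (by rw [uIcc_of_le hab]; exact hg.integrableOn_Icc)
  rwa [uIcc_of_le hab] at this

/-- Gronwall's inequality in integral form, with an inhomogeneous term. -/
theorem gronwall_le_integral {Y Y' g k : ℝ → ℝ} {a b : ℝ} (hab : a ≤ b)
    (hY : ContinuousOn Y (Icc a b)) (hY' : ∀ τ ∈ Ioo a b, HasDerivAt Y (Y' τ) τ)
    (hg : ContinuousOn g (Icc a b)) (hk : ContinuousOn k (Icc a b))
    (hle : ∀ τ ∈ Ioo a b, Y' τ ≤ g τ + k τ * Y τ) :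
    Y b ≤ Y a * (1 + ∫ σ in a..b, k σ * Real.exp (∫ l in σ..b, k l)) + (∫ σ in a..b, g σ)
      + ∫ σ in a..b, (∫ l in a..σ, g l) * (k σ * Real.exp (∫ l in σ..b, k l)) := by
  set H : ℝ → ℝ := fun x => ∫ l in a..x, k l with hH
  set F : ℝ → ℝ := fun x => ∫ l in a..x, g l with hF
  have hHc : ContinuousOn H (Icc a b) := continuousOn_primitive_of_continuousOn hab hk
  have hFc : ContinuousOn F (Icc a b) := continuousOn_primitive_of_continuousOn hab hg
  set N : ℝ → ℝ := fun σ => (Y a + F σ) * (k σ * Real.exp (-H σ)) with hN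
  have hec : ContinuousOn (fun σ => Real.exp (-H σ)) (Icc a b) := hHc.neg.rexp
  have hNc : ContinuousOn N (Icc a b) := (continuousOn_const.add hFc).mul (hk.mul hec)
  -- With the integrating factor, the derivative of `Θ` is `exp(-H) (Y' - g - kY) ≤ 0`. Subtracting
  -- `Y a + F` first yields the bound in terms of `F`, with no integration by parts and no sign
  -- condition on `k` or `g`.
  set Θ : ℝ → ℝ := fun τ => Real.exp (-H τ) * (Y τ - Y a - F τ) - ∫ l in a..τ, N l with hΘ
  have hΘc : ContinuousOn Θ (Icc a b) :=
    (hec.mul ((hY.sub continuousOn_const).sub hFc)).sub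
      (continuousOn_primitive_of_continuousOn hab hNc)
  have hΘd : ∀ τ ∈ Ioo a b,
      HasDerivAt Θ (Real.exp (-H τ) * (Y' τ - g τ - k τ * Y τ)) τ := by
    intro τ hτ
    have h1 := (hasDerivAt_primitive_of_mem_Ioo hk hτ).neg.exp
    have h2 := ((hY' τ hτ).sub_const (Y a)).sub (hasDerivAt_primitive_of_mem_Ioo hg hτ)
    have h3 := (h1.mul h2).sub (hasDerivAt_primitive_of_mem_Ioo hNc hτ)
    refine h3.congr_deriv ?_
    simp only [hN, hH, hF, Pi.neg_apply, Pi.sub_apply]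
    ring
  have hanti : AntitoneOn Θ (Icc a b) := by
    refine antitoneOn_of_deriv_nonpos (convex_Icc a b) hΘc ?_ ?_
    · intro τ hτ
      rw [interior_Icc] at hτ
      exact (hΘd τ hτ).differentiableAt.differentiableWithinAt
    · intro τ hτ
      rw [interior_Icc] at hτ
      rw [(hΘd τ hτ).deriv]
      have := hle τ hτ
      exact mul_nonpos_of_nonneg_of_nonpos (Real.exp_pos _).le (by linarith)
  have hfin : Θ b ≤ Θ a := hanti (left_mem_Icc.2 hab) (right_mem_Icc.2 hab) hab
  have hΘa : Θ a = 0 := by simp [hΘ, hF]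
  rw [hΘa] at hfin
  have hexp : ∀ σ ∈ Icc a b,
      Real.exp (∫ l in σ..b, k l) = Real.exp (H b) * Real.exp (-H σ) := by
    intro σ hσ
    rw [← Real.exp_add]
    congr 1
    have i1 : IntervalIntegrable k volume a σ := (hk.mono (by
      rw [uIcc_of_le hσ.1]; exact Icc_subset_Icc_right hσ.2)).intervalIntegrable
    have i2 : IntervalIntegrable k volume σ b := (hk.mono (by
      rw [uIcc_of_le hσ.2]; exact Icc_subset_Icc_left hσ.1)).intervalIntegrable
    have := intervalIntegral.integral_add_adjacent_intervals i1 i2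
    simp only [hH]
    linarith
  have e1 : (∫ σ in a..b, k σ * Real.exp (∫ l in σ..b, k l))
      = Real.exp (H b) * ∫ σ in a..b, k σ * Real.exp (-H σ) := by
    rw [← intervalIntegral.integral_const_mul]
    refine intervalIntegral.integral_congr fun σ hσ => ?_
    rw [uIcc_of_le hab] at hσ
    simp only [hexp σ hσ]
    ring
  have e2 : (∫ σ in a..b, F σ * (k σ * Real.exp (∫ l in σ..b, k l)))
      = Real.exp (H b) * ∫ σ in a..b, F σ * (k σ * Real.exp (-H σ)) := by
    rw [← intervalIntegral.integral_const_mul]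
    refine intervalIntegral.integral_congr fun σ hσ => ?_
    rw [uIcc_of_le hab] at hσ
    simp only [hexp σ hσ]
    ring
  have e3 : (∫ σ in a..b, N σ) = Y a * (∫ σ in a..b, k σ * Real.exp (-H σ))
      + ∫ σ in a..b, F σ * (k σ * Real.exp (-H σ)) := by
    rw [← intervalIntegral.integral_const_mul, ← intervalIntegral.integral_add]
    · refine intervalIntegral.integral_congr fun σ _ => ?_
      simp only [hN]
      ring
    · exact ContinuousOn.intervalIntegrable
        (by rw [uIcc_of_le hab]; exact continuousOn_const.mul (hk.mul hec))
    · exact ContinuousOn.intervalIntegrable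
        (by rw [uIcc_of_le hab]; exact hFc.mul (hk.mul hec))
  rw [e1, e2]
  simp only [hΘ] at hfin
  rw [e3] at hfin
  have hpos := Real.exp_pos (H b)
  have hmul := mul_le_mul_of_nonneg_left hfin hpos.le
  have hone : Real.exp (H b) * Real.exp (-H b) = 1 := by rw [← Real.exp_add]; simp
  have hexpand : Real.exp (H b) * (Real.exp (-H b) * (Y b - Y a - F b)) = Y b - Y a - F b := by
    rw [← mul_assoc, hone, one_mul]
  rw [mul_zero, mul_sub, hexpand] at hmul
  simp only [hF] at hmul ⊢
  linarith

/-- The energy estimate for `(1 + η) w'' + c² w = G`. -/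
theorem sqrt_energy_le {c δ a b : ℝ} (hδ₀ : 0 < δ) (hδ₁ : δ < 1) (hab : a ≤ b)
    {w w' w'' η η' G : ℝ → ℝ}
    (hw : ∀ τ ∈ Icc a b, HasDerivAt w (w' τ) τ) (hw' : ∀ τ ∈ Icc a b, HasDerivAt w' (w'' τ) τ)
    (hη : ∀ τ ∈ Icc a b, HasDerivAt η (η' τ) τ) (hηδ : ∀ τ ∈ Icc a b, |η τ| ≤ δ)
    (hη' : ContinuousOn η' (Icc a b)) (hG : ContinuousOn G (Icc a b))
    (heq : ∀ τ ∈ Icc a b, (1 + η τ) * w'' τ + c ^ 2 * w τ = G τ) :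
    √(w' b ^ 2 + c ^ 2 * w b ^ 2 / (1 + η b)) ≤ (1 / (1 - δ)) ^ 2 *
      (√(w' a ^ 2 + c ^ 2 * w a ^ 2 / (1 + η a)) *
          (1 + ∫ σ in a..b, |η' σ| * Real.exp (1 / (1 - δ) * ∫ l in σ..b, |η' l|))
        + (∫ σ in a..b, |G σ|)
        + ∫ σ in a..b, (∫ l in a..σ, |G l|) *
            (|η' σ| * Real.exp (1 / (1 - δ) * ∫ l in σ..b, |η' l|))) := by
  set C : ℝ := 1 / (1 - δ) with hC
  have hδ' : 0 < 1 - δ := by linarith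
  have hC1 : 1 ≤ C := by rw [hC, le_div_iff₀ hδ']; linarith
  have hC0 : 0 < C := by linarith
  have hq : ∀ τ ∈ Icc a b, 1 - δ ≤ 1 + η τ := fun τ hτ => by
    linarith [(abs_le.1 (hηδ τ hτ)).1]
  set E : ℝ → ℝ := fun τ => w' τ ^ 2 + c ^ 2 * w τ ^ 2 / (1 + η τ) with hE
  have hE0 : ∀ τ ∈ Icc a b, 0 ≤ E τ := fun τ hτ => by
    have := hq τ hτ
    have h1 : 0 ≤ 1 + η τ := by linarith
    simp only [hE]
    positivity
  -- The weight `1 / (1 + η)` is chosen so that `2 w' w''` and `2 c² w w' / (1 + η)` add up, by the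
  -- equation, to `2 w' G / (1 + η)`.
  set E' : ℝ → ℝ := fun τ => 2 * w' τ * (G τ / (1 + η τ)) - c ^ 2 * w τ ^ 2 * η' τ / (1 + η τ) ^ 2
    with hE'
  have hEd : ∀ τ ∈ Icc a b, HasDerivAt E (E' τ) τ := by
    intro τ hτ
    have hne : 1 + η τ ≠ 0 := by have := hq τ hτ; linarith
    have h1 := ((hw' τ hτ).pow 2).add
      ((((hw τ hτ).pow 2).const_mul (c ^ 2)).div ((hη τ hτ).const_add 1) hne)
    refine h1.congr_deriv ?_
    simp only [hE', ← heq τ hτ, Pi.pow_apply]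
    field_simp
    ring
  -- The square root is not differentiable where `E` vanishes, so `E + ε` is used; the resulting
  -- bound passes to the limit `ε → 0`.
  have hEle : ∀ τ ∈ Icc a b, ∀ ε > 0,
      E' τ / (2 * √(E τ + ε)) ≤ C * |G τ| + C * |η' τ| * √(E τ + ε) := by
    intro τ hτ ε hε
    have hq' := hq τ hτ
    have hqp : 0 < 1 + η τ := by linarith
    have hEε : 0 < E τ + ε := by linarith [hE0 τ hτ]
    set y := √(E τ + ε) with hy
    have hypos : 0 < y := Real.sqrt_pos.2 hEε
    have hysq : y ^ 2 = E τ + ε := Real.sq_sqrt hEε.le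
    have hinv : 1 / (1 + η τ) ≤ C := one_div_le_one_div_of_le hδ' hq'
    have hwy : |w' τ| ≤ y := by
      refine abs_le_of_sq_le_sq ?_ hypos.le
      rw [hysq]
      have : 0 ≤ c ^ 2 * w τ ^ 2 / (1 + η τ) := by positivity
      simp only [hE]
      linarith
    have hwE : c ^ 2 * w τ ^ 2 / (1 + η τ) ≤ y ^ 2 := by
      rw [hysq]
      simp only [hE]
      nlinarith [sq_nonneg (w' τ)]
    have t1 : 2 * w' τ * (G τ / (1 + η τ)) ≤ 2 * y * (C * |G τ|) := by
      calc 2 * w' τ * (G τ / (1 + η τ)) ≤ |2 * w' τ * (G τ / (1 + η τ))| := le_abs_self _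
        _ = 2 * |w' τ| * (1 / (1 + η τ) * |G τ|) := by
            rw [abs_mul, abs_mul, abs_div, abs_of_pos hqp, abs_two]; ring
        _ ≤ 2 * y * (C * |G τ|) := by gcongr
    have t2 : -(c ^ 2 * w τ ^ 2 * η' τ / (1 + η τ) ^ 2) ≤ y ^ 2 * (C * |η' τ|) := by
      calc -(c ^ 2 * w τ ^ 2 * η' τ / (1 + η τ) ^ 2)
          = c ^ 2 * w τ ^ 2 / (1 + η τ) * (1 / (1 + η τ) * -η' τ) := by field_simp
        _ ≤ c ^ 2 * w τ ^ 2 / (1 + η τ) * (1 / (1 + η τ) * |η' τ|) := by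
            gcongr; exact neg_le_abs _
        _ ≤ y ^ 2 * (C * |η' τ|) := by gcongr
    rw [div_le_iff₀ (by positivity)]
    have t3 : 0 ≤ y ^ 2 * (C * |η' τ|) := by positivity
    simp only [hE']
    nlinarith
  set I := ∫ σ in a..b, |η' σ| * Real.exp (C * ∫ l in σ..b, |η' l|) with hI
  set J := ∫ σ in a..b, (∫ l in a..σ, |G l|) * (|η' σ| * Real.exp (C * ∫ l in σ..b, |η' l|))
    with hJ
  set F := ∫ σ in a..b, |G σ| with hF
  have hF0 : 0 ≤ F := intervalIntegral.integral_nonneg hab fun _ _ => abs_nonneg _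
  have hI0 : 0 ≤ I := intervalIntegral.integral_nonneg hab fun _ _ => by positivity
  have hJ0 : 0 ≤ J := intervalIntegral.integral_nonneg hab fun σ hσ =>
    mul_nonneg (intervalIntegral.integral_nonneg hσ.1 fun _ _ => abs_nonneg _) (by positivity)
  have hεb : ∀ ε > 0, √(E b + ε) ≤ √(E a + ε) * (1 + C * I) + C * F + C ^ 2 * J := by
    intro ε hε
    have hd : ∀ τ ∈ Icc a b,
        HasDerivAt (fun τ => √(E τ + ε)) (E' τ / (2 * √(E τ + ε))) τ := fun τ hτ =>
      ((hEd τ hτ).add_const ε).sqrt (by linarith [hE0 τ hτ])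
    have := gronwall_le_integral (g := fun τ => C * |G τ|) (k := fun τ => C * |η' τ|) hab
      (fun τ hτ => (hd τ hτ).continuousAt.continuousWithinAt)
      (fun τ hτ => hd τ (Ioo_subset_Icc_self hτ))
      (continuousOn_const.mul hG.abs) (continuousOn_const.mul hη'.abs)
      (fun τ hτ => hEle τ (Ioo_subset_Icc_self hτ) ε hε)
    simp only [intervalIntegral.integral_const_mul] at this
    have e1 : (∫ σ in a..b, C * |η' σ| * Real.exp (C * ∫ l in σ..b, |η' l|)) = C * I := by
      rw [hI, ← intervalIntegral.integral_const_mul]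
      simp only [mul_assoc]
    have e2 : (∫ σ in a..b, (C * ∫ l in a..σ, |G l|) *
        (C * |η' σ| * Real.exp (C * ∫ l in σ..b, |η' l|))) = C ^ 2 * J := by
      rw [hJ, ← intervalIntegral.integral_const_mul]
      refine intervalIntegral.integral_congr fun σ _ => ?_
      ring
    rw [e1, e2] at this
    exact this
  have hlim : √(E b) ≤ √(E a) * (1 + C * I) + C * F + C ^ 2 * J := by
    have l1 : Tendsto (fun ε => √(E b + ε)) (𝓝[>] 0) (𝓝 (√(E b + 0))) :=
      ((by fun_prop : Continuous fun ε => √(E b + ε)).tendsto 0).mono_left nhdsWithin_le_nhds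
    have l2 : Tendsto (fun ε => √(E a + ε) * (1 + C * I) + C * F + C ^ 2 * J) (𝓝[>] 0)
        (𝓝 (√(E a + 0) * (1 + C * I) + C * F + C ^ 2 * J)) :=
      ((by fun_prop : Continuous fun ε =>
        √(E a + ε) * (1 + C * I) + C * F + C ^ 2 * J).tendsto 0).mono_left nhdsWithin_le_nhds
    have := le_of_tendsto_of_tendsto l1 l2
      (eventually_nhdsWithin_of_forall fun ε hε => hεb ε hε)
    simpa using this
  refine hlim.trans ?_
  -- Since `C ≥ 1`, the factors `1`, `C` and `C²` of the separate terms are all at most `C²`.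
  have hCC : C ≤ C ^ 2 := by nlinarith
  have h1C : 1 ≤ C ^ 2 := by nlinarith
  have hy0 := Real.sqrt_nonneg (E a)
  have k1 : √(E a) * (1 + C * I) ≤ C ^ 2 * (√(E a) * (1 + I)) := by
    calc √(E a) * (1 + C * I) ≤ √(E a) * (C ^ 2 * 1 + C ^ 2 * I) := by gcongr; linarith
      _ = _ := by ring
  have k2 : C * F ≤ C ^ 2 * F := by gcongr
  linarith

/-! ### Differential calculus in the hyperboloidal frame. -/

namespace HypKG

theorem pd_mul {u w : Spacetime → ℝ} {p : Spacetime} (α : Fin 4) (hu : DifferentiableAt ℝ u p)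
    (hw : DifferentiableAt ℝ w p) :
    pd α (fun q => u q * w q) p = pd α u p * w p + u p * pd α w p := by
  simp only [pd, fderiv_fun_mul hu hw, add_apply,
    smul_apply, smul_eq_mul]
  ring

theorem pd_add {u w : Spacetime → ℝ} {p : Spacetime} (α : Fin 4) (hu : DifferentiableAt ℝ u p)
    (hw : DifferentiableAt ℝ w p) :
    pd α (fun q => u q + w q) p = pd α u p + pd α w p := by
  simp only [pd, fderiv_fun_add hu hw, add_apply]

theorem pd_sum {ι : Type*} (S : Finset ι) {u : ι → Spacetime → ℝ} {p : Spacetime} (α : Fin 4)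
    (hu : ∀ i ∈ S, DifferentiableAt ℝ (u i) p) :
    pd α (fun q => ∑ i ∈ S, u i q) p = ∑ i ∈ S, pd α (u i) p := by
  simp only [pd, fderiv_fun_sum hu, sum_apply]

theorem differentiableAt_div {u w : Spacetime → ℝ} {p : Spacetime} (hu : DifferentiableAt ℝ u p)
    (hw : DifferentiableAt ℝ w p) (h0 : w p ≠ 0) : DifferentiableAt ℝ (fun q => u q / w q) p := by
  simpa only [div_eq_mul_inv] using hu.fun_mul (hw.fun_inv h0)

theorem pd_div {u w : Spacetime → ℝ} {p : Spacetime} (α : Fin 4) (hu : DifferentiableAt ℝ u p)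
    (hw : DifferentiableAt ℝ w p) (h0 : w p ≠ 0) :
    pd α (fun q => u q / w q) p = (pd α u p * w p - u p * pd α w p) / w p ^ 2 := by
  have hd : DifferentiableAt ℝ (fun q => u q / w q) p := differentiableAt_div hu hw h0
  have hne : ∀ᶠ q in 𝓝 p, w q ≠ 0 := hw.continuousAt.eventually_ne h0
  have he : u =ᶠ[𝓝 p] fun q => u q / w q * w q := by
    filter_upwards [hne] with q hq
    field_simp
  have h1 : pd α u p = pd α (fun q => u q / w q * w q) p := by
    simp only [pd, he.fderiv_eq]
  rw [pd_mul α hd hw] at h1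
  rw [h1]
  field_simp
  ring

/-- The points of the open future light cone. -/
def Timelike (p : Spacetime) : Prop := 0 < p.1 ∧ ‖p.2‖ ^ 2 < p.1 ^ 2

theorem isOpen_timelike : IsOpen {p : Spacetime | Timelike p} :=
  (isOpen_lt continuous_const continuous_fst).inter
    (isOpen_lt (f := fun p : Spacetime => ‖p.2‖ ^ 2) (g := fun p : Spacetime => p.1 ^ 2)
      (by fun_prop) (by fun_prop))

theorem Timelike.eventually {p : Spacetime} (hp : Timelike p) : ∀ᶠ q in 𝓝 p, Timelike q :=
  isOpen_timelike.mem_nhds hp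

theorem Timelike.radius_pos {p : Spacetime} (hp : Timelike p) : 0 < hypRadius p :=
  Real.sqrt_pos.2 (by linarith [hp.2])

theorem Timelike.radius_sq {p : Spacetime} (hp : Timelike p) :
    hypRadius p ^ 2 = p.1 ^ 2 - ‖p.2‖ ^ 2 :=
  Real.sq_sqrt (by linarith [hp.2])

theorem Timelike.radius_sq' {p : Spacetime} (hp : Timelike p) :
    hypRadius p ^ 2 = p.1 ^ 2 - ∑ a, p.2 a ^ 2 := by
  rw [hp.radius_sq, EuclideanSpace.real_norm_sq_eq]

theorem Timelike.contDiffAt_radius {p : Spacetime} (hp : Timelike p) :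
    ContDiffAt ℝ 2 hypRadius p := by
  refine ContDiffAt.sqrt ?_ (by linarith [hp.2])
  exact (contDiffAt_fst.pow 2).sub (contDiffAt_snd.norm_sq ℝ)

theorem Timelike.differentiableAt_radius {p : Spacetime} (hp : Timelike p) :
    DifferentiableAt ℝ hypRadius p := hp.contDiffAt_radius.differentiableAt (by norm_num)

theorem differentiableAt_coord (p : Spacetime) (a : Fin 3) :
    DifferentiableAt ℝ (fun q : Spacetime => q.2 a) p := by fun_prop

theorem pd_time (α : Fin 4) (p : Spacetime) :
    pd α (fun q => q.1) p = if α = 0 then 1 else 0 := by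
  have : fderiv ℝ (fun q : Spacetime => q.1) p = ContinuousLinearMap.fst ℝ ℝ Space := fderiv_fst
  rw [pd, this]
  refine Fin.cases ?_ (fun b => ?_) α <;> simp [basisVec]

theorem pd_coord (α : Fin 4) (a : Fin 3) (p : Spacetime) :
    pd α (fun q => q.2 a) p = if α = a.succ then 1 else 0 := by
  have : HasFDerivAt (fun q : Spacetime => q.2 a)
      ((EuclideanSpace.proj a : Space →L[ℝ] ℝ).comp (ContinuousLinearMap.snd ℝ ℝ Space)) p :=
    ((EuclideanSpace.proj a : Space →L[ℝ] ℝ).comp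
      (ContinuousLinearMap.snd ℝ ℝ Space)).hasFDerivAt
  rw [pd, this.fderiv]
  refine Fin.cases ?_ (fun b => ?_) α
  · simp [basisVec, (Fin.succ_ne_zero a).symm]
  · simp [basisVec, Fin.succ_inj, eq_comm]

theorem pd_radius {p : Spacetime} (hp : Timelike p) (α : Fin 4) :
    pd α hypRadius p = Psi 0 α p := by
  -- The polynomial identity `s² = t² - |x|²` is differentiated in place of the square root.
  have he : (fun q => hypRadius q * hypRadius q) =ᶠ[𝓝 p]
      fun q : Spacetime => q.1 * q.1 + ∑ a, (-1) * (q.2 a * q.2 a) := by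
    filter_upwards [hp.eventually] with q hq
    have := hq.radius_sq'
    rw [← Finset.mul_sum]
    simp only [← sq]
    linarith
  have hs := hp.radius_pos
  have h1 : pd α (fun q => hypRadius q * hypRadius q) p
      = pd α (fun q : Spacetime => q.1 * q.1 + ∑ a, (-1) * (q.2 a * q.2 a)) p := by
    simp only [pd, he.fderiv_eq]
  rw [pd_mul α hp.differentiableAt_radius hp.differentiableAt_radius,
    pd_add α (by fun_prop) (by fun_prop), pd_mul α (by fun_prop) (by fun_prop),
    pd_sum _ α (fun i _ => by fun_prop), pd_time] at h1
  have h2 : ∀ a : Fin 3, pd α (fun q : Spacetime => (-1) * (q.2 a * q.2 a)) p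
      = -2 * p.2 a * (if α = a.succ then 1 else 0) := fun a => by
    rw [pd_mul α (by fun_prop) (by fun_prop), pd_mul α (by fun_prop) (by fun_prop), pd_coord]
    simp only [pd, fderiv_fun_const]
    split_ifs
    · simp
      ring
    · simp
  simp only [h2] at h1
  revert h1
  refine Fin.cases ?_ (fun b => ?_) α
  · intro h1
    simp [(Fin.succ_ne_zero _).symm] at h1
    simp only [Psi, Fin.cases_zero]
    field_simp
    linarith
  · intro h1
    simp [Fin.succ_inj] at h1
    simp only [Psi, Fin.cases_zero, Fin.cases_succ]
    field_simp
    linarith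

theorem Timelike.differentiableAt_psi {p : Spacetime} (hp : Timelike p) (γ β : Fin 4) :
    DifferentiableAt ℝ (Psi γ β) p := by
  have hs := hp.differentiableAt_radius
  have h0 := hp.radius_pos.ne'
  refine Fin.cases ?_ (fun a => ?_) γ
  · refine Fin.cases ?_ (fun b => ?_) β
    · exact differentiableAt_div differentiableAt_fst hs h0
    · exact differentiableAt_div (differentiableAt_coord p b).fun_neg hs h0
  · exact differentiableAt_const _

theorem Timelike.contDiffAt_psi {p : Spacetime} (hp : Timelike p) (γ β : Fin 4) :
    ContDiffAt ℝ 1 (Psi γ β) p := by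
  have hs : ContDiffAt ℝ 1 hypRadius p := hp.contDiffAt_radius.of_le (by norm_num)
  have h0 := hp.radius_pos.ne'
  refine Fin.cases ?_ (fun a => ?_) γ
  · refine Fin.cases ?_ (fun b => ?_) β
    · exact contDiffAt_fst.div hs h0
    · exact ContDiffAt.div (ContDiffAt.neg (by fun_prop)) hs h0
  · exact contDiffAt_const

theorem differentiableAt_pd {v : Spacetime → ℝ} {p : Spacetime} (hv : ContDiffAt ℝ 2 v p)
    (α : Fin 4) : DifferentiableAt ℝ (pd α v) p := by
  have : DifferentiableAt ℝ (fderiv ℝ v) p :=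
    (hv.fderiv_right (m := 1) (by norm_num)).differentiableAt (by norm_num)
  exact this.clm_apply (differentiableAt_const _)

theorem pd_comm {v : Spacetime → ℝ} {p : Spacetime} (hv : ContDiffAt ℝ 2 v p) (α β : Fin 4) :
    pd α (pd β v) p = pd β (pd α v) p := by
  have hd : DifferentiableAt ℝ (fderiv ℝ v) p :=
    (hv.fderiv_right (m := 1) (by norm_num)).differentiableAt (by norm_num)
  have key : ∀ α β : Fin 4, pd α (pd β v) p
      = fderiv ℝ (fderiv ℝ v) p (basisVec α) (basisVec β) := fun α β => by
    have : HasFDerivAt (pd β v) _ p := hd.hasFDerivAt.clm_apply (hasFDerivAt_const (basisVec β) p)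
    rw [pd, this.fderiv]
    simp
  rw [key, key]
  exact (hv.isSymmSndFDerivAt (by simp)).eq _ _

theorem hypD_zero (u : Spacetime → ℝ) (p : Spacetime) :
    hypD 0 u p = hypRadius p / p.1 * pd 0 u p := rfl

theorem hypD_succ (a : Fin 3) (u : Spacetime → ℝ) (p : Spacetime) :
    hypD a.succ u p = pd a.succ u p + p.2 a / p.1 * pd 0 u p := rfl

theorem Timelike.differentiableAt_hypD {p : Spacetime} (hp : Timelike p) {v : Spacetime → ℝ}
    (hv : ContDiffAt ℝ 2 v p) (γ : Fin 4) : DifferentiableAt ℝ (hypD γ v) p := by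
  have h0 := hp.1.ne'
  refine Fin.cases ?_ (fun a => ?_) γ
  · exact (differentiableAt_div hp.differentiableAt_radius differentiableAt_fst h0).mul (differentiableAt_pd hv 0)
  · exact (differentiableAt_pd hv _).add
      ((differentiableAt_div (differentiableAt_coord p a) differentiableAt_fst h0).mul (differentiableAt_pd hv 0))

theorem pd_eq_sum_hypD {p : Spacetime} (hp : Timelike p) (β : Fin 4) (u : Spacetime → ℝ) :
    pd β u p = ∑ γ, Psi γ β p * hypD γ u p := by
  have hs := hp.radius_pos.ne'
  have ht := hp.1.ne'
  rw [Fin.sum_univ_succ]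
  simp only [hypD_zero, hypD_succ, Psi, Fin.cases_zero, Fin.cases_succ]
  refine Fin.cases ?_ (fun b => ?_) β
  · simp [(Fin.succ_ne_zero _).symm]
    field_simp
  · simp [Fin.succ_inj]
    field_simp
    ring

/-- The Hessian in the hyperboloidal frame. -/
theorem pd_pd_eq_sum_hypD {p : Spacetime} (hp : Timelike p) {v : Spacetime → ℝ}
    (hv : ContDiffAt ℝ 2 v p) (α β : Fin 4) :
    pd α (pd β v) p = ∑ γ, (pd α (Psi γ β) p * hypD γ v p
      + Psi γ β p * ∑ δ, Psi δ α p * hypD δ (hypD γ v) p) := by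
  have he : pd β v =ᶠ[𝓝 p] fun q => ∑ γ, Psi γ β q * hypD γ v q := by
    filter_upwards [hp.eventually] with q hq using pd_eq_sum_hypD hq β v
  have h1 : pd α (pd β v) p = pd α (fun q => ∑ γ, Psi γ β q * hypD γ v q) p := by
    rw [pd, pd, he.fderiv_eq]
  rw [h1, pd_sum (u := fun γ q => Psi γ β q * hypD γ v q) _ α fun γ _ =>
    (hp.differentiableAt_psi γ β).mul (hp.differentiableAt_hypD hv γ)]
  refine Finset.sum_congr rfl fun γ _ => ?_
  rw [pd_mul α (hp.differentiableAt_psi γ β) (hp.differentiableAt_hypD hv γ),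
    ← pd_eq_sum_hypD hp α]

/-- The second-order part transforms as a tensor; the remaining first-order sum comes from
differentiating the transition matrix, and is the last term of `R₂`. -/
theorem sum_metric_hessian {p : Spacetime} (hp : Timelike p) {v : Spacetime → ℝ}
    (hv : ContDiffAt ℝ 2 v p) (h : Fin 4 → Fin 4 → Spacetime → ℝ) :
    ∑ α, ∑ β, h α β p * pd α (pd β v) p
      = ∑ δ, ∑ γ, hbar h δ γ p * hypD δ (hypD γ v) p
        + ∑ α, ∑ β, ∑ γ, h α β p * pd α (Psi γ β) p * hypD γ v p := by
  have e1 : ∀ α β, h α β p * pd α (pd β v) p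
      = (∑ δ, ∑ γ, Psi δ α p * Psi γ β p * h α β p * hypD δ (hypD γ v) p)
        + ∑ γ, h α β p * pd α (Psi γ β) p * hypD γ v p := fun α β => by
    rw [pd_pd_eq_sum_hypD hp hv, Finset.sum_comm, Finset.mul_sum, ← Finset.sum_add_distrib]
    refine Finset.sum_congr rfl fun γ _ => ?_
    rw [mul_add, Finset.mul_sum, Finset.mul_sum, add_comm, mul_assoc]
    congr 1
    exact Finset.sum_congr rfl fun δ _ => by ring
  simp only [e1, Finset.sum_add_distrib]
  congr 1
  have e2 : ∀ δ γ, hbar h δ γ p * hypD δ (hypD γ v) p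
      = ∑ α, ∑ β, Psi δ α p * Psi γ β p * h α β p * hypD δ (hypD γ v) p := fun δ γ => by
    simp only [hbar, Finset.sum_mul]
  simp only [e2]
  calc _ = ∑ α, ∑ δ, ∑ β, ∑ γ, Psi δ α p * Psi γ β p * h α β p * hypD δ (hypD γ v) p :=
        Finset.sum_congr rfl fun α _ => Finset.sum_comm
    _ = ∑ δ, ∑ α, ∑ γ, ∑ β, Psi δ α p * Psi γ β p * h α β p * hypD δ (hypD γ v) p := by
        rw [Finset.sum_comm]
        exact Finset.sum_congr rfl fun δ _ => Finset.sum_congr rfl fun α _ => Finset.sum_comm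
    _ = _ := Finset.sum_congr rfl fun δ _ => Finset.sum_comm

theorem hbar_comm {h : Fin 4 → Fin 4 → Spacetime → ℝ} {p : Spacetime}
    (hs : ∀ α β, h α β p = h β α p) (γ δ : Fin 4) : hbar h γ δ p = hbar h δ γ p := by
  rw [hbar, hbar, Finset.sum_comm]
  refine Finset.sum_congr rfl fun μ _ => Finset.sum_congr rfl fun ν _ => ?_
  rw [hs ν μ]
  ring

theorem fderiv_apply_self (u : Spacetime → ℝ) (p q : Spacetime) :
    fderiv ℝ u p q = q.1 * pd 0 u p + ∑ a : Fin 3, q.2 a * pd a.succ u p := by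
  have : q = q.1 • basisVec 0 + ∑ a : Fin 3, q.2 a • basisVec a.succ := by
    refine Prod.ext ?_ ?_
    · simp [basisVec, Prod.fst_sum]
    · ext i
      simp [basisVec, Fin.sum_univ_three]
      fin_cases i <;> simp
  conv_lhs => rw [this]
  simp [pd]

/-- The derivative along the ray through `p`. -/
theorem fderiv_ray {p : Spacetime} (hp : Timelike p) (u : Spacetime → ℝ) :
    fderiv ℝ u p ((hypRadius p)⁻¹ • p)
      = hypD 0 u p + ∑ a : Fin 3, p.2 a / hypRadius p * hypD a.succ u p := by
  have hs := hp.radius_pos.ne'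
  have ht := hp.1.ne'
  have hsq := hp.radius_sq'
  rw [map_smul, fderiv_apply_self]
  simp only [hypD_zero, hypD_succ, Fin.sum_univ_three, smul_eq_mul] at hsq ⊢
  field_simp
  linear_combination (-pd 0 u p) * hsq

theorem pd_radius_div_time {p : Spacetime} (hp : Timelike p) (α : Fin 4) :
    pd α (fun q => hypRadius q / q.1) p
      = (Psi 0 α p * p.1 - hypRadius p * if α = 0 then 1 else 0) / p.1 ^ 2 := by
  rw [pd_div α hp.differentiableAt_radius differentiableAt_fst hp.1.ne', pd_radius hp, pd_time]

theorem pd_hypD_zero {p : Spacetime} (hp : Timelike p) {v : Spacetime → ℝ}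
    (hv : ContDiffAt ℝ 2 v p) (α : Fin 4) :
    pd α (hypD 0 v) p = (Psi 0 α p * p.1 - hypRadius p * if α = 0 then 1 else 0) / p.1 ^ 2
      * pd 0 v p + hypRadius p / p.1 * pd α (pd 0 v) p := by
  rw [← pd_radius_div_time hp]
  exact pd_mul α (differentiableAt_div hp.differentiableAt_radius differentiableAt_fst hp.1.ne')
    (differentiableAt_pd hv 0)

theorem pd_hypD_succ {p : Spacetime} (hp : Timelike p) {v : Spacetime → ℝ}
    (hv : ContDiffAt ℝ 2 v p) (α : Fin 4) (a : Fin 3) :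
    pd α (hypD a.succ v) p = pd α (pd a.succ v) p
      + ((((if α = a.succ then 1 else 0) * p.1 - p.2 a * if α = 0 then 1 else 0) / p.1 ^ 2)
        * pd 0 v p + p.2 a / p.1 * pd α (pd 0 v) p) := by
  have hd : DifferentiableAt ℝ (fun q : Spacetime => q.2 a / q.1) p :=
    differentiableAt_div (differentiableAt_coord p a) differentiableAt_fst hp.1.ne'
  rw [← pd_coord, ← pd_time, ← pd_div α (differentiableAt_coord p a) differentiableAt_fst hp.1.ne',
    ← pd_mul α hd (differentiableAt_pd hv 0)]
  exact pd_add α (differentiableAt_pd hv _) (hd.mul (differentiableAt_pd hv 0))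

/-- Both fields belong to the coordinate frame of `(s, x)`, so they commute on functions of class
`C²`. -/
theorem hypD_comm {p : Spacetime} (hp : Timelike p) {v : Spacetime → ℝ}
    (hv : ContDiffAt ℝ 2 v p) (a : Fin 3) :
    hypD a.succ (hypD 0 v) p = hypD 0 (hypD a.succ v) p := by
  have hs := hp.radius_pos.ne'
  have ht := hp.1.ne'
  rw [hypD_succ, hypD_zero, pd_hypD_zero hp hv, pd_hypD_zero hp hv, pd_hypD_succ hp hv,
    pd_comm hv a.succ 0]
  simp only [Psi, Fin.cases_zero, Fin.cases_succ, Fin.succ_ne_zero, (Fin.succ_ne_zero a).symm,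
    if_true, if_false]
  field_simp
  ring

/-! ### The wave operator in the frame and the equation along rays. -/

/-- The flat wave operator in the hyperboloidal frame. -/
theorem flat_box_eq {p : Spacetime} (hp : Timelike p) {v : Spacetime → ℝ}
    (hv : ContDiffAt ℝ 2 v p) :
    pd 0 (pd 0 v) p - ∑ a : Fin 3, pd a.succ (pd a.succ v) p
      = hypD 0 (hypD 0 v) p
        + 2 * (∑ a : Fin 3, p.2 a / hypRadius p * hypD 0 (hypD a.succ v) p)
        - ∑ a : Fin 3, hypD a.succ (hypD a.succ v) p + 3 / hypRadius p * hypD 0 v p := by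
  have hs := hp.radius_pos.ne'
  have ht := hp.1.ne'
  have hsq := hp.radius_sq'
  have e0 : hypD 0 (hypD 0 v) p = (1 / p.1 - hypRadius p ^ 2 / p.1 ^ 3) * pd 0 v p
      + hypRadius p ^ 2 / p.1 ^ 2 * pd 0 (pd 0 v) p := by
    rw [hypD_zero, pd_hypD_zero hp hv]
    simp only [Psi, Fin.cases_zero, if_true]
    field_simp
  have e1 : ∀ a : Fin 3, p.2 a / hypRadius p * hypD 0 (hypD a.succ v) p
      = p.2 a / p.1 * pd 0 (pd a.succ v) p
        + p.2 a ^ 2 * (pd 0 (pd 0 v) p / p.1 ^ 2 - pd 0 v p / p.1 ^ 3) := fun a => by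
    rw [hypD_zero, pd_hypD_succ hp hv]
    simp only [(Fin.succ_ne_zero a).symm, if_true, if_false]
    field_simp
    ring
  have e2 : ∀ a : Fin 3, hypD a.succ (hypD a.succ v) p = pd a.succ (pd a.succ v) p
      + pd 0 v p / p.1 + 2 * (p.2 a / p.1 * pd 0 (pd a.succ v) p)
      + p.2 a ^ 2 * (pd 0 (pd 0 v) p / p.1 ^ 2 - pd 0 v p / p.1 ^ 3) := fun a => by
    rw [hypD_succ, pd_hypD_succ hp hv, pd_hypD_succ hp hv, pd_comm hv a.succ 0]
    simp only [Fin.succ_ne_zero, (Fin.succ_ne_zero a).symm, if_true, if_false]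
    field_simp
    ring
  have e3 : 3 / hypRadius p * hypD 0 v p = 3 * pd 0 v p / p.1 := by
    rw [hypD_zero]; field_simp
  simp only [e0, e1, e2, e3, Finset.sum_add_distrib, ← Finset.mul_sum, ← Finset.sum_mul,
    Finset.sum_const, Finset.card_univ, Fintype.card_fin, nsmul_eq_mul]
  -- With `|x|² + s² = t²`, the coefficient of `∂_t² v` sums to `1` and that of `∂_t v` to `0`; the
  -- three terms `∂_t v / t` from `∑ ∂̄_a ∂̄_a v` are compensated by `(3/s) ∂̄_0 v`.
  have hX : ∑ a, p.2 a ^ 2 = p.1 ^ 2 - hypRadius p ^ 2 := by linarith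
  rw [hX]
  field_simp
  push_cast
  ring

/-- The derivative along the ray through `p`, in the hyperboloidal frame. -/
noncomputable def rayD (v : Spacetime → ℝ) (p : Spacetime) : ℝ :=
  hypD 0 v p + ∑ a : Fin 3, p.2 a / hypRadius p * hypD a.succ v p

/-- The second derivative along the ray through `p`, in the hyperboloidal frame. -/
noncomputable def rayDD (v : Spacetime → ℝ) (p : Spacetime) : ℝ :=
  hypD 0 (hypD 0 v) p + 2 * (∑ a : Fin 3, p.2 a / hypRadius p * hypD 0 (hypD a.succ v) p)
    + ∑ a : Fin 3, ∑ b : Fin 3,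
        p.2 a * p.2 b / hypRadius p ^ 2 * hypD a.succ (hypD b.succ v) p

/-- Symmetry of `h̄` and commutation of the frame merge the `0b` and `b0` terms, whence the factor
`2`. -/
theorem reducedBox_eq {p : Spacetime} (hp : Timelike p) {v : Spacetime → ℝ}
    (hv : ContDiffAt ℝ 2 v p) {h : Fin 4 → Fin 4 → Spacetime → ℝ}
    (hs : ∀ α β, h α β p = h β α p) :
    -reducedBox h v p
      = (1 + hbar h 0 0 p) * hypD 0 (hypD 0 v) p
        + 2 * (∑ a : Fin 3, p.2 a / hypRadius p * hypD 0 (hypD a.succ v) p)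
        - ∑ a : Fin 3, hypD a.succ (hypD a.succ v) p + 3 / hypRadius p * hypD 0 v p
        + (∑ b : Fin 3, 2 * hbar h 0 b.succ p * hypD 0 (hypD b.succ v) p
          + ∑ a : Fin 3, ∑ b : Fin 3, hbar h a.succ b.succ p * hypD a.succ (hypD b.succ v) p
          + ∑ α, ∑ β, ∑ γ, h α β p * pd α (Psi γ β) p * hypD γ v p) := by
  have h1 : -reducedBox h v p = (pd 0 (pd 0 v) p - ∑ a : Fin 3, pd a.succ (pd a.succ v) p)
      + ∑ α, ∑ β, h α β p * pd α (pd β v) p := by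
    simp only [reducedBox, sub_mul, Finset.sum_sub_distrib]
    have : ∑ α, ∑ β, mink α β * pd α (pd β v) p
        = -pd 0 (pd 0 v) p + ∑ a : Fin 3, pd a.succ (pd a.succ v) p := by
      simp only [mink, ite_mul, zero_mul, Finset.sum_ite_eq, Finset.mem_univ, if_true]
      rw [Fin.sum_univ_succ]
      simp [Fin.succ_ne_zero]
    rw [this]
    ring
  have h2 : ∑ δ, ∑ γ, hbar h δ γ p * hypD δ (hypD γ v) p
      = hbar h 0 0 p * hypD 0 (hypD 0 v) p
        + ∑ b : Fin 3, 2 * hbar h 0 b.succ p * hypD 0 (hypD b.succ v) p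
        + ∑ a : Fin 3, ∑ b : Fin 3, hbar h a.succ b.succ p * hypD a.succ (hypD b.succ v) p := by
    rw [Fin.sum_univ_succ, Fin.sum_univ_succ]
    have : ∀ a : Fin 3, ∑ γ, hbar h a.succ γ p * hypD a.succ (hypD γ v) p
        = hbar h 0 a.succ p * hypD 0 (hypD a.succ v) p
          + ∑ b : Fin 3, hbar h a.succ b.succ p * hypD a.succ (hypD b.succ v) p := fun a => by
      rw [Fin.sum_univ_succ, hbar_comm hs a.succ 0, hypD_comm hp hv]
    simp only [this, Finset.sum_add_distrib, mul_assoc, ← Finset.mul_sum]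
    ring
  rw [h1, flat_box_eq hp hv, sum_metric_hessian hp hv, h2]
  ring

/-- The wave equation as an ordinary differential equation along rays. -/
theorem ray_equation {c : ℝ} {p : Spacetime} (hp : Timelike p) {f v : Spacetime → ℝ}
    (hv : ContDiffAt ℝ 2 v p) {h : Fin 4 → Fin 4 → Spacetime → ℝ}
    (hs : ∀ α β, h α β p = h β α p) (heq : -reducedBox h v p + c ^ 2 * v p = f p) :
    (1 + hbar h 0 0 p) * (3 / (4 * hypRadius p ^ (1 / 2 : ℝ)) * v p
        + 3 * hypRadius p ^ (1 / 2 : ℝ) * rayD v p + hypRadius p ^ (3 / 2 : ℝ) * rayDD v p)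
      + c ^ 2 * (hypRadius p ^ (3 / 2 : ℝ) * v p)
      = R₁ v p + R₂ h v p + R₃ h v p + hypRadius p ^ (3 / 2 : ℝ) * f p := by
  have hs0 := hp.radius_pos
  rw [reducedBox_eq hp hv hs] at heq
  have hk : hypRadius p ^ (3 / 2 : ℝ) = hypRadius p * hypRadius p ^ (1 / 2 : ℝ) := by
    rw [show (3 / 2 : ℝ) = 1 + 1 / 2 by norm_num, Real.rpow_add hs0, Real.rpow_one]
  have hk2 : hypRadius p = (hypRadius p ^ (1 / 2 : ℝ)) ^ 2 := by
    rw [← Real.rpow_natCast, ← Real.rpow_mul hs0.le]; norm_num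
  have hk0 : 0 < hypRadius p ^ (1 / 2 : ℝ) := Real.rpow_pos_of_pos hs0 _
  rw [← heq]
  simp only [R₁, R₂, R₃, rayD, rayDD]
  rw [hk]
  -- In the variable `k = s^{1/2}` all powers of `s` are integral, and once the sums are made opaque
  -- the claim is an identity of rational functions.
  generalize hypRadius p ^ (1 / 2 : ℝ) = k at *
  generalize hypRadius p = s at *
  subst hk2
  have e1 : ∑ a : Fin 3, p.2 a / k ^ 2 * hypD a.succ v p
      = (∑ a : Fin 3, p.2 a * hypD a.succ v p) / k ^ 2 := by
    rw [Finset.sum_div]; exact Finset.sum_congr rfl fun a _ => by ring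
  have e2 : ∑ a : Fin 3, p.2 a / k ^ 2 * hypD 0 (hypD a.succ v) p
      = (∑ a : Fin 3, p.2 a * hypD 0 (hypD a.succ v) p) / k ^ 2 := by
    rw [Finset.sum_div]; exact Finset.sum_congr rfl fun a _ => by ring
  have e3 : ∑ a : Fin 3, ∑ b : Fin 3, p.2 a * p.2 b / (k ^ 2) ^ 2 * hypD a.succ (hypD b.succ v) p
      = (∑ a : Fin 3, ∑ b : Fin 3, p.2 a * p.2 b * hypD a.succ (hypD b.succ v) p) / k ^ 4 := by
    simp only [Finset.sum_div]
    exact Finset.sum_congr rfl fun a _ => Finset.sum_congr rfl fun b _ => by ring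
  have e4 : ∑ a : Fin 3, 3 * p.2 a / (k ^ 2) ^ 2 * hypD a.succ v p
      = 3 * (∑ a : Fin 3, p.2 a * hypD a.succ v p) / k ^ 4 := by
    rw [Finset.mul_sum, Finset.sum_div]; exact Finset.sum_congr rfl fun a _ => by ring
  have e5 : ∑ a : Fin 3, 2 * p.2 a * k * hypD 0 (hypD a.succ v) p
      = 2 * k * ∑ a : Fin 3, p.2 a * hypD 0 (hypD a.succ v) p := by
    rw [Finset.mul_sum]; exact Finset.sum_congr rfl fun a _ => by ring
  have e6 : ∑ a : Fin 3, 3 * p.2 a / k * hypD a.succ v p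
      = 3 * (∑ a : Fin 3, p.2 a * hypD a.succ v p) / k := by
    rw [Finset.mul_sum, Finset.sum_div]; exact Finset.sum_congr rfl fun a _ => by ring
  have e7 : ∑ a : Fin 3, ∑ b : Fin 3, p.2 a * p.2 b / k * hypD a.succ (hypD b.succ v) p
      = (∑ a : Fin 3, ∑ b : Fin 3, p.2 a * p.2 b * hypD a.succ (hypD b.succ v) p) / k := by
    simp only [Finset.sum_div]
    exact Finset.sum_congr rfl fun a _ => Finset.sum_congr rfl fun b _ => by ring
  rw [e1, e2, e3, e4, e5, e6, e7]
  generalize (∑ a : Fin 3, p.2 a * hypD a.succ v p) = X1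
  generalize (∑ a : Fin 3, p.2 a * hypD 0 (hypD a.succ v) p) = X2
  generalize (∑ a : Fin 3, ∑ b : Fin 3, p.2 a * p.2 b * hypD a.succ (hypD b.succ v) p) = X3
  generalize (∑ b : Fin 3, 2 * hbar h 0 b.succ p * hypD 0 (hypD b.succ v) p) = X4
  generalize (∑ a : Fin 3, ∑ b : Fin 3, hbar h a.succ b.succ p * hypD a.succ (hypD b.succ v) p) = X5
  generalize (∑ α, ∑ β, ∑ γ, h α β p * pd α (Psi γ β) p * hypD γ v p) = X6
  generalize (∑ a : Fin 3, hypD a.succ (hypD a.succ v) p) = X7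
  field_simp
  ring

/-! ### Rays -/

theorem ray_eq_smul (p : Spacetime) (l : ℝ) : ray p l = l • ((hypRadius p)⁻¹ • p) := by
  ext
  · simp [ray]; ring
  · simp [ray, smul_smul, div_eq_mul_inv]

theorem Timelike.ray {p : Spacetime} (hp : Timelike p) {l : ℝ} (hl : 0 < l) :
    Timelike (ray p l) := by
  have hs := hp.radius_pos
  refine ⟨div_pos (mul_pos hl hp.1) hs, ?_⟩
  simp only [HypKG.ray, norm_smul, Real.norm_eq_abs, mul_pow, sq_abs, div_pow]
  rw [div_mul_eq_mul_div]
  exact div_lt_div_of_pos_right (mul_lt_mul_of_pos_left hp.2 (by positivity)) (by positivity)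

theorem Timelike.radius_ray {p : Spacetime} (hp : Timelike p) {l : ℝ} (hl : 0 < l) :
    hypRadius (HypKG.ray p l) = l := by
  have hs := hp.radius_pos
  have h1 := (hp.ray hl).radius_sq
  have : hypRadius (HypKG.ray p l) ^ 2 = l ^ 2 := by
    rw [h1]
    simp only [HypKG.ray, norm_smul, Real.norm_eq_abs, mul_pow, sq_abs, div_pow]
    have := hp.radius_sq
    field_simp
    linarith
  exact (pow_left_inj₀ (hp.ray hl).radius_pos.le hl.le two_ne_zero).1 this

theorem Timelike.ray_radius {p : Spacetime} (hp : Timelike p) :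
    HypKG.ray p (hypRadius p) = p := by
  rw [ray_eq_smul, smul_smul, mul_inv_cancel₀ hp.radius_pos.ne', one_smul]

theorem hasDerivAt_ray (p : Spacetime) (l : ℝ) :
    HasDerivAt (ray p) ((hypRadius p)⁻¹ • p) l := by
  have : ray p = fun l => l • ((hypRadius p)⁻¹ • p) := funext (ray_eq_smul p)
  rw [this]
  simpa using (hasDerivAt_id l).smul_const ((hypRadius p)⁻¹ • p)

theorem contDiff_ray (p : Spacetime) : ContDiff ℝ 2 (ray p) := by
  have : ray p = fun l => l • ((hypRadius p)⁻¹ • p) := funext (ray_eq_smul p)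
  rw [this]
  fun_prop

theorem Timelike.inv_radius_smul_ray {p : Spacetime} (hp : Timelike p) {l : ℝ} (hl : 0 < l) :
    (hypRadius (HypKG.ray p l))⁻¹ • HypKG.ray p l = (hypRadius p)⁻¹ • p := by
  rw [hp.radius_ray hl, ray_eq_smul, smul_smul, inv_mul_cancel₀ hl.ne', one_smul]

/-- The ratios `x^a / s` are constant on a ray, so the coefficients of `rayD` are not differentiated
in the second derivative. -/
theorem Timelike.coord_ray {p : Spacetime} (hp : Timelike p) {l : ℝ} (hl : 0 < l) (a : Fin 3) :
    (HypKG.ray p l).2 a / hypRadius (HypKG.ray p l) = p.2 a / hypRadius p := by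
  have hs := hp.radius_pos.ne'
  have hl0 := hl.ne'
  rw [hp.radius_ray hl]
  simp only [HypKG.ray, PiLp.smul_apply, smul_eq_mul]
  field_simp

theorem hasDerivAt_comp_ray {p : Spacetime} (hp : Timelike p) {l : ℝ} (hl : 0 < l)
    {u : Spacetime → ℝ} (hu : DifferentiableAt ℝ u (ray p l)) :
    HasDerivAt (fun l => u (ray p l)) (rayD u (ray p l)) l := by
  have := hu.hasFDerivAt.comp_hasDerivAt l (hasDerivAt_ray p l)
  rwa [← hp.inv_radius_smul_ray hl, fderiv_ray (hp.ray hl)] at this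

theorem hasDerivAt_rayD {p : Spacetime} (hp : Timelike p) {l : ℝ} (hl : 0 < l)
    {v : Spacetime → ℝ} (hv : ContDiffAt ℝ 2 v (ray p l)) :
    HasDerivAt (fun l => rayD v (ray p l)) (rayDD v (ray p l)) l := by
  have hd := fun γ => hasDerivAt_comp_ray hp hl ((hp.ray hl).differentiableAt_hypD hv γ)
  have h1 : HasDerivAt (fun l => hypD 0 v (ray p l)
      + ∑ a : Fin 3, p.2 a / hypRadius p * hypD a.succ v (ray p l))
      (rayD (hypD 0 v) (ray p l)
        + ∑ a : Fin 3, p.2 a / hypRadius p * rayD (hypD a.succ v) (ray p l)) l :=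
    (hd 0).add (HasDerivAt.fun_sum fun a _ => (hd a.succ).const_mul _)
  have he : (fun l => rayD v (ray p l)) =ᶠ[𝓝 l] fun l => hypD 0 v (ray p l)
      + ∑ a : Fin 3, p.2 a / hypRadius p * hypD a.succ v (ray p l) := by
    filter_upwards [lt_mem_nhds hl] with m hm
    simp only [rayD, hp.coord_ray hm]
  refine (h1.congr_of_eventuallyEq he).congr_deriv ?_
  simp only [← hp.coord_ray hl]
  simp only [rayD, rayDD, hypD_comm (hp.ray hl) hv, mul_add, Finset.sum_add_distrib, two_mul,
    ← add_assoc, add_right_inj]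
  simp only [Finset.mul_sum]
  rw [Finset.sum_comm]
  refine Finset.sum_congr rfl fun a _ => Finset.sum_congr rfl fun b _ => ?_
  ring

theorem contDiffAt_deriv {g : ℝ → ℝ} {x : ℝ} {m n : WithTop ℕ∞} (hg : ContDiffAt ℝ n g x)
    (hmn : m + 1 ≤ n) : ContDiffAt ℝ m (deriv g) x := by
  have : deriv g = fun y => fderiv ℝ g y 1 := funext fun y => (fderiv_apply_one_eq_deriv).symm
  rw [this]
  exact (hg.fderiv_right hmn).clm_apply contDiffAt_const

/-- The solution along the ray through `p`, with the weight `λ^{3/2}`. -/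
noncomputable def rayW (v : Spacetime → ℝ) (p : Spacetime) (l : ℝ) : ℝ := l ^ (3 / 2 : ℝ) * v (ray p l)

theorem contDiffAt_rayW {p : Spacetime} {l : ℝ} (hl : 0 < l) {v : Spacetime → ℝ}
    (hv : ContDiffAt ℝ 2 v (ray p l)) : ContDiffAt ℝ 2 (rayW v p) l :=
  (Real.contDiffAt_rpow_const_of_ne hl.ne').mul (hv.comp l (contDiff_ray p).contDiffAt)

theorem hasDerivAt_rpow_three_half {l : ℝ} (hl : 0 < l) :
    HasDerivAt (fun l : ℝ => l ^ (3 / 2 : ℝ)) (3 / 2 * l ^ (1 / 2 : ℝ)) l := by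
  have := Real.hasDerivAt_rpow_const (x := l) (p := 3 / 2) (Or.inl hl.ne')
  rwa [show (3 / 2 - 1 : ℝ) = 1 / 2 by norm_num] at this

theorem hasDerivAt_rpow_half {l : ℝ} (hl : 0 < l) :
    HasDerivAt (fun l : ℝ => l ^ (1 / 2 : ℝ)) (1 / (2 * l ^ (1 / 2 : ℝ))) l := by
  have := Real.hasDerivAt_rpow_const (x := l) (p := 1 / 2) (Or.inl hl.ne')
  rw [show (1 / 2 - 1 : ℝ) = -(1 / 2) by norm_num, Real.rpow_neg hl.le] at this
  refine this.congr_deriv ?_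
  ring

theorem deriv_rayW {p : Spacetime} (hp : Timelike p) {l : ℝ} (hl : 0 < l)
    {v : Spacetime → ℝ} (hv : ContDiffAt ℝ 2 v (ray p l)) :
    deriv (rayW v p) l
      = 3 / 2 * l ^ (1 / 2 : ℝ) * v (ray p l) + l ^ (3 / 2 : ℝ) * rayD v (ray p l) :=
  ((hasDerivAt_rpow_three_half hl).mul
    (hasDerivAt_comp_ray hp hl (hv.differentiableAt (by norm_num)))).deriv

theorem deriv_deriv_rayW {p : Spacetime} (hp : Timelike p) {l : ℝ} (hl : 0 < l)
    {v : Spacetime → ℝ} (hv : ContDiffAt ℝ 2 v (ray p l)) :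
    deriv (deriv (rayW v p)) l
      = 3 / (4 * l ^ (1 / 2 : ℝ)) * v (ray p l) + 3 * l ^ (1 / 2 : ℝ) * rayD v (ray p l)
        + l ^ (3 / 2 : ℝ) * rayDD v (ray p l) := by
  have he : deriv (rayW v p) =ᶠ[𝓝 l] fun l =>
      3 / 2 * l ^ (1 / 2 : ℝ) * v (ray p l) + l ^ (3 / 2 : ℝ) * rayD v (ray p l) := by
    have hev := (hasDerivAt_ray p l).continuousAt.eventually (hv.eventually (by simp))
    filter_upwards [hev, lt_mem_nhds hl] with m hm hm0 using deriv_rayW hp hm0 hm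
  rw [he.deriv_eq]
  have h1 := hasDerivAt_comp_ray hp hl (hv.differentiableAt (by norm_num))
  have h2 := (((hasDerivAt_rpow_half hl).const_mul (3 / 2)).mul h1).add
    ((hasDerivAt_rpow_three_half hl).mul (hasDerivAt_rayD hp hl hv))
  refine h2.deriv.trans ?_
  have : l ^ (1 / 2 : ℝ) ≠ 0 := (Real.rpow_pos_of_pos hl _).ne'
  field_simp
  ring

/-- Both sides are the derivative of `v` in the direction `p / s`. -/
theorem time_div_radius_mul_perp {p : Spacetime} (hp : Timelike p) (v : Spacetime → ℝ) :
    p.1 / hypRadius p * perp v p = rayD v p := by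
  have hs := hp.radius_pos.ne'
  have ht := hp.1.ne'
  rw [rayD, ← fderiv_ray hp, map_smul, fderiv_apply_self, perp, smul_eq_mul]
  simp only [Fin.sum_univ_three]
  field_simp

/-! ### The future of the initial hyperboloid -/

theorem timelike_of_mem_future {s₀ : ℝ} (hs₀ : 1 < s₀) {p : Spacetime} (hp : p ∈ future s₀) :
    Timelike p := ⟨hp.1, by nlinarith [hp.2]⟩

theorem le_radius_of_mem_future {s₀ : ℝ} {p : Spacetime} (hp : p ∈ future s₀) :
    s₀ ≤ hypRadius p := Real.le_sqrt_of_sq_le hp.2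

theorem ray_mem_future {s₀ : ℝ} (hs₀ : 1 < s₀) {p : Spacetime} (hp : Timelike p) {l : ℝ}
    (hl : s₀ ≤ l) : ray p l ∈ future s₀ := by
  have hl0 : 0 < l := by linarith
  refine ⟨(hp.ray hl0).1, ?_⟩
  rw [← (hp.ray hl0).radius_sq, hp.radius_ray hl0]
  gcongr

theorem Timelike.eq_hypPoint {q : Spacetime} (hq : Timelike q) :
    q = hypPoint (hypRadius q) q.2 := by
  refine Prod.ext ?_ rfl
  simp only [hypPoint]
  rw [hq.radius_sq, sub_add_cancel, Real.sqrt_sq hq.1.le]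

theorem continuous_hypPoint (s : ℝ) : Continuous (hypPoint s) := by
  unfold hypPoint
  fun_prop

theorem isClosed_coneK : IsClosed coneK :=
  isClosed_le (f := fun p : Spacetime => ‖p.2‖) (g := fun p : Spacetime => p.1 - 1)
    (by fun_prop) (by fun_prop)

theorem hypPoint_mem_future {s₀ : ℝ} (hs₀ : 1 < s₀) (x : Space) : hypPoint s₀ x ∈ future s₀ := by
  refine ⟨Real.sqrt_pos.2 (by positivity), ?_⟩
  simp only [hypPoint]
  rw [Real.sq_sqrt (by positivity)]
  linarith

/-- Squaring `r + 1 ≤ √(s₀² + r²)` gives `2r + 1 ≤ s₀²`. This bounds the support of the data. -/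
theorem norm_le_of_hypPoint_mem_coneK {s₀ : ℝ} {x : Space} (hx : hypPoint s₀ x ∈ coneK) :
    ‖x‖ ≤ s₀ ^ 2 := by
  have h1 : ‖x‖ + 1 ≤ √(s₀ ^ 2 + ‖x‖ ^ 2) := by
    have : ‖x‖ ≤ √(s₀ ^ 2 + ‖x‖ ^ 2) - 1 := hx
    linarith
  have h2 := Real.le_sqrt' (by positivity) |>.1 h1
  nlinarith [norm_nonneg x]

theorem contDiff_hypPoint {s₀ : ℝ} (hs₀ : 1 < s₀) : ContDiff ℝ 2 (hypPoint s₀) := by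
  refine ContDiff.prodMk ?_ contDiff_id
  exact ContDiff.sqrt (contDiff_const.add (contDiff_id.norm_sq ℝ)) fun x => by positivity

theorem fderiv_hypPoint_self {s₀ : ℝ} (hs₀ : 1 < s₀) (x : Space) :
    fderiv ℝ (hypPoint s₀) x x = (‖x‖ ^ 2 / √(s₀ ^ 2 + ‖x‖ ^ 2), x) := by
  have hpos : s₀ ^ 2 + ‖x‖ ^ 2 ≠ 0 := by positivity
  have h1 : HasFDerivAt (fun x : Space => s₀ ^ 2 + ‖x‖ ^ 2) (2 • innerSL ℝ x) x :=
    (hasStrictFDerivAt_norm_sq x).hasFDerivAt.const_add _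
  have h2 : HasFDerivAt (hypPoint s₀) _ x := (h1.sqrt hpos).prodMk (hasFDerivAt_id x)
  rw [h2.fderiv]
  ext
  · simp
    ring
  · simp

/-! ### The initial data and their norms. -/

section Data

variable {c s₀ : ℝ} {h : Fin 4 → Fin 4 → Spacetime → ℝ} {f v : Spacetime → ℝ}
  {v₀ v₁ : Space → ℝ}

theorem IsKGSolution.data_zero_eq (H : IsKGSolution c s₀ h f v₀ v₁ v) :
    v₀ = v ∘ hypPoint s₀ := funext fun x => (H.data_zero x).symm

theorem IsKGSolution.contDiff_data_zero (H : IsKGSolution c s₀ h f v₀ v₁ v) (hs₀ : 1 < s₀) :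
    ContDiff ℝ 2 v₀ := by
  rw [H.data_zero_eq, contDiff_iff_contDiffAt]
  exact fun x => (H.sol_smooth _ (hypPoint_mem_future hs₀ x)).comp x
    (contDiff_hypPoint hs₀).contDiffAt

theorem IsKGSolution.continuous_data_one (H : IsKGSolution c s₀ h f v₀ v₁ v) (hs₀ : 1 < s₀) :
    Continuous v₁ := by
  have : v₁ = pd 0 v ∘ hypPoint s₀ := funext fun x => (H.data_one x).symm
  rw [this, continuous_iff_continuousAt]
  exact fun x => (differentiableAt_pd (H.sol_smooth _ (hypPoint_mem_future hs₀ x))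
    0).continuousAt.comp (continuous_hypPoint s₀).continuousAt

theorem IsKGSolution.hasCompactSupport (H : IsKGSolution c s₀ h f v₀ v₁ v) :
    HasCompactSupport v₀ ∧ HasCompactSupport v₁ := by
  have : ∀ x ∉ Metric.closedBall (0 : Space) (s₀ ^ 2), v₀ x = 0 ∧ v₁ x = 0 := fun x hx =>
    H.data_supp x fun hK => hx (by simpa using norm_le_of_hypPoint_mem_coneK hK)
  exact ⟨HasCompactSupport.intro (isCompact_closedBall _ _) fun x hx => (this x hx).1,
    HasCompactSupport.intro (isCompact_closedBall _ _) fun x hx => (this x hx).2⟩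

/-- Compact support makes the family bounded; for an unbounded one the real supremum would be the
default value `0`. -/
theorem abs_le_supNorm {w : Space → ℝ} (hw : Continuous w) (hc : HasCompactSupport w) (x : Space) :
    |w x| ≤ supNorm w := by
  obtain ⟨M, hM⟩ := hw.bounded_above_of_compact_support hc
  exact le_ciSup (f := fun x => |w x|) ⟨M, by rintro _ ⟨y, rfl⟩; exact hM y⟩ x

theorem norm_fderiv_le_supNormGrad {w : Space → ℝ} (hw : ContDiff ℝ 2 w)
    (hc : HasCompactSupport w) (x : Space) : ‖fderiv ℝ w x‖ ≤ supNormGrad w := by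
  obtain ⟨M, hM⟩ := (hw.continuous_fderiv (by norm_num)).bounded_above_of_compact_support
    (hc.fderiv ℝ)
  exact le_ciSup (f := fun x => ‖fderiv ℝ w x‖) ⟨M, by rintro _ ⟨y, rfl⟩; exact hM y⟩ x

theorem supNorm_nonneg (w : Space → ℝ) : 0 ≤ supNorm w := Real.iSup_nonneg fun _ => abs_nonneg _

theorem supNormGrad_nonneg (w : Space → ℝ) : 0 ≤ supNormGrad w :=
  Real.iSup_nonneg fun _ => norm_nonneg _

/-- The complement of `K` is open, so `v₀` vanishes in a whole neighbourhood of `x`. -/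
theorem IsKGSolution.fderiv_data_eq_zero (H : IsKGSolution c s₀ h f v₀ v₁ v) {x : Space}
    (hx : hypPoint s₀ x ∉ coneK) : fderiv ℝ v₀ x = 0 := by
  have hev : ∀ᶠ y in 𝓝 x, hypPoint s₀ y ∉ coneK :=
    (continuous_hypPoint s₀).continuousAt.eventually (isClosed_coneK.isOpen_compl.mem_nhds hx)
  have : v₀ =ᶠ[𝓝 x] fun _ => 0 := by
    filter_upwards [hev] with y hy using (H.data_supp y hy).1
  rw [this.fderiv_eq]
  simp

/-- The ray direction `(t, x) / s₀` splits into the tangent vector `(r²/t, x) / s₀` of the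
hyperboloid, which acts on `v₀`, and `(s₀/t) ∂_t`, which gives `v₁`. -/
theorem IsKGSolution.rayD_hypPoint (H : IsKGSolution c s₀ h f v₀ v₁ v) (hs₀ : 1 < s₀)
    (x : Space) : rayD v (hypPoint s₀ x)
      = s₀ / √(s₀ ^ 2 + ‖x‖ ^ 2) * v₁ x + s₀⁻¹ * fderiv ℝ v₀ x x := by
  have hF := hypPoint_mem_future hs₀ x
  have hp := timelike_of_mem_future hs₀ hF
  have hT : 0 < √(s₀ ^ 2 + ‖x‖ ^ 2) := hp.1
  have hTsq : √(s₀ ^ 2 + ‖x‖ ^ 2) ^ 2 = s₀ ^ 2 + ‖x‖ ^ 2 := Real.sq_sqrt (by positivity)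
  have hr : hypRadius (hypPoint s₀ x) = s₀ := by
    rw [hypRadius]
    simp only [hypPoint]
    rw [hTsq, add_sub_cancel_right, Real.sqrt_sq (by linarith)]
  have hd : fderiv ℝ v₀ x x
      = fderiv ℝ v (hypPoint s₀ x) (‖x‖ ^ 2 / √(s₀ ^ 2 + ‖x‖ ^ 2), x) := by
    rw [H.data_zero_eq, fderiv_comp x ((H.sol_smooth _ hF).differentiableAt (by norm_num))
      ((contDiff_hypPoint hs₀).contDiffAt.differentiableAt (by norm_num)),
      ContinuousLinearMap.comp_apply, fderiv_hypPoint_self hs₀]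
  rw [rayD, ← fderiv_ray hp, map_smul, hr, hd, fderiv_apply_self, fderiv_apply_self,
    H.data_one x, smul_eq_mul]
  simp only [hypPoint]
  field_simp
  linear_combination v₁ x * hTsq

theorem IsKGSolution.abs_rayD_hypPoint_le (H : IsKGSolution c s₀ h f v₀ v₁ v) (hs₀ : 1 < s₀)
    (x : Space) : |rayD v (hypPoint s₀ x)| ≤ supNorm v₁ + s₀ * supNormGrad v₀ := by
  have hs0 : 0 < s₀ := by linarith
  obtain ⟨hc0, hc1⟩ := H.hasCompactSupport
  have h1 := abs_le_supNorm (H.continuous_data_one hs₀) hc1 x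
  have hT : s₀ ≤ √(s₀ ^ 2 + ‖x‖ ^ 2) := Real.le_sqrt_of_sq_le (by nlinarith [norm_nonneg x])
  have hg : |fderiv ℝ v₀ x x| ≤ s₀ ^ 2 * supNormGrad v₀ := by
    by_cases hx : hypPoint s₀ x ∈ coneK
    · calc |fderiv ℝ v₀ x x| ≤ ‖fderiv ℝ v₀ x‖ * ‖x‖ := (fderiv ℝ v₀ x).le_opNorm x
        _ ≤ supNormGrad v₀ * s₀ ^ 2 := by
          gcongr
          · exact supNormGrad_nonneg v₀
          · exact norm_fderiv_le_supNormGrad (H.contDiff_data_zero hs₀) hc0 x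
          · exact norm_le_of_hypPoint_mem_coneK hx
        _ = _ := mul_comm _ _
    · rw [H.fderiv_data_eq_zero hx]
      simpa using mul_nonneg (sq_nonneg s₀) (supNormGrad_nonneg v₀)
  rw [H.rayD_hypPoint hs₀]
  calc _ ≤ s₀ / √(s₀ ^ 2 + ‖x‖ ^ 2) * |v₁ x| + s₀⁻¹ * |fderiv ℝ v₀ x x| := by
        refine (abs_add_le _ _).trans_eq ?_
        rw [abs_mul, abs_mul, abs_of_nonneg (by positivity : 0 ≤ s₀ / √(s₀ ^ 2 + ‖x‖ ^ 2)),
          abs_of_pos (inv_pos.2 hs0)]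
    _ ≤ 1 * supNorm v₁ + s₀⁻¹ * (s₀ ^ 2 * supNormGrad v₀) := by
        gcongr
        exact div_le_one_of_le₀ hT (by linarith)
    _ = _ := by field_simp

end Data

/-! ### Entry of rays into the cone. -/

/-- The case `b < m` occurs when `p` lies outside `K`, before its ray has entered: the integral from
`m` to `b` then runs backwards, and both sides are zero. -/
theorem integral_eq_of_eq_zero_on_Ioo {g : ℝ → ℝ} {a m b : ℝ} (hab : a ≤ b) (ham : a ≤ m)
    (h0 : ∀ x ∈ Ioo a m, g x = 0) : ∫ x in a..b, g x = ∫ x in m..b, g x := by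
  have hne : ∀ᵐ x : ℝ, x ≠ m := by simp [ae_iff]
  rcases le_total m b with hmb | hbm
  · rw [intervalIntegral.integral_of_le hab, intervalIntegral.integral_of_le hmb]
    refine setIntegral_eq_of_subset_of_ae_sdiff_eq_zero measurableSet_Ioc.nullMeasurableSet
      (Ioc_subset_Ioc_left ham) ?_
    filter_upwards [hne] with x hx hmem
    refine h0 x ⟨hmem.1.1, lt_of_le_of_ne (not_lt.1 fun hlt => hmem.2 ⟨hlt, hmem.1.2⟩) hx⟩
  · rw [intervalIntegral.integral_zero_ae, intervalIntegral.integral_zero_ae]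
    · filter_upwards [hne] with x hx hmem
      rw [uIoc_of_ge hbm] at hmem
      exact h0 x ⟨hab.trans_lt hmem.1, lt_of_le_of_ne hmem.2 hx⟩
    · filter_upwards [hne] with x hx hmem
      rw [uIoc_of_le hab] at hmem
      exact h0 x ⟨hmem.1, lt_of_le_of_ne (hmem.2.trans hbm) hx⟩

/-- The source of the ordinary differential equation along the rays. -/
noncomputable def source (h : Fin 4 → Fin 4 → Spacetime → ℝ) (f v : Spacetime → ℝ)
    (p : Spacetime) : ℝ :=
  R₁ v p + R₂ h v p + R₃ h v p + hypRadius p ^ (3 / 2 : ℝ) * f p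

theorem entryRadius_eq {p : Spacetime} (hp : Timelike p) :
    0 < p.1 - ‖p.2‖ ∧ entryRadius p = hypRadius p / (p.1 - ‖p.2‖) := by
  have h1 : 0 < p.1 - ‖p.2‖ := by
    have := abs_lt_of_sq_lt_sq hp.2 hp.1.le
    rw [abs_norm] at this
    linarith
  refine ⟨h1, ?_⟩
  have h2 : 0 < p.1 + ‖p.2‖ := by linarith [norm_nonneg p.2]
  have : (p.1 + ‖p.2‖) / (p.1 - ‖p.2‖) = (p.1 ^ 2 - ‖p.2‖ ^ 2) / (p.1 - ‖p.2‖) ^ 2 := by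
    field_simp
    ring
  rw [entryRadius, this, Real.sqrt_div (by nlinarith), Real.sqrt_sq h1.le, hypRadius]

theorem ray_notMem_coneK {p : Spacetime} (hp : Timelike p) {l : ℝ} (hl0 : 0 < l)
    (hl : l < entryRadius p) : ray p l ∉ coneK := by
  obtain ⟨h1, h2⟩ := entryRadius_eq hp
  have hs := hp.radius_pos
  rw [h2, lt_div_iff₀ h1] at hl
  intro hK
  have hK' : ‖(l / hypRadius p) • p.2‖ ≤ l * p.1 / hypRadius p - 1 := hK
  rw [norm_smul, Real.norm_eq_abs, abs_of_pos (by positivity), div_mul_eq_mul_div, div_sub_one hs.ne',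
    div_le_div_iff_of_pos_right hs] at hK'
  linarith

/-- The threshold on `r/t` is the condition `s₀² < (t + r) / (t - r)` solved for `r/t`. -/
theorem lt_entryRadius {s₀ : ℝ} (hs₀ : 1 < s₀) {p : Spacetime} (hp : Timelike p)
    (hfar : (s₀ ^ 2 - 1) / (1 + s₀ ^ 2) < ‖p.2‖ / p.1) : s₀ < entryRadius p := by
  obtain ⟨h1, -⟩ := entryRadius_eq hp
  rw [div_lt_div_iff₀ (by positivity) hp.1] at hfar
  refine Real.lt_sqrt_of_sq_lt ?_
  rw [lt_div_iff₀ h1]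
  linarith

/-! ### The energy of a solution along a ray. -/

section Solution

variable {c s₀ δ : ℝ} {h : Fin 4 → Fin 4 → Spacetime → ℝ} {f v : Spacetime → ℝ}
  {v₀ v₁ : Space → ℝ}

theorem IsKGSolution.contDiffAt_hRay (H : IsKGSolution c s₀ h f v₀ v₁ v) (hs₀ : 1 < s₀)
    {p : Spacetime} (hp : Timelike p) {l : ℝ} (hl : s₀ ≤ l) : ContDiffAt ℝ 1 (hRay h p) l := by
  have hq := ray_mem_future hs₀ hp hl
  have hqT := timelike_of_mem_future hs₀ hq
  have h1 : ContDiffAt ℝ 1 (hbar h 0 0) (ray p l) :=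
    ContDiffAt.sum fun μ _ => ContDiffAt.sum fun ν _ =>
      ((hqT.contDiffAt_psi 0 μ).mul (hqT.contDiffAt_psi 0 ν)).mul (H.metric_smooth _ hq μ ν)
  exact h1.comp l ((contDiff_ray p).of_le (by norm_num)).contDiffAt

theorem IsKGSolution.contDiffAt_rayW (H : IsKGSolution c s₀ h f v₀ v₁ v) (hs₀ : 1 < s₀)
    {p : Spacetime} (hp : Timelike p) {l : ℝ} (hl : s₀ ≤ l) : ContDiffAt ℝ 2 (rayW v p) l :=
  HypKG.contDiffAt_rayW (by linarith) (H.sol_smooth _ (ray_mem_future hs₀ hp hl))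

theorem IsKGSolution.rayW_equation (H : IsKGSolution c s₀ h f v₀ v₁ v) (hs₀ : 1 < s₀)
    {p : Spacetime} (hp : Timelike p) {l : ℝ} (hl : s₀ ≤ l) :
    (1 + hRay h p l) * deriv (deriv (rayW v p)) l + c ^ 2 * rayW v p l
      = source h f v (ray p l) := by
  have hl0 : 0 < l := by linarith
  have hq := ray_mem_future hs₀ hp hl
  have hqT := timelike_of_mem_future hs₀ hq
  have hv := H.sol_smooth _ hq
  rw [deriv_deriv_rayW hp hl0 hv, source, ← ray_equation hqT hv (H.metric_symm _ hq)
    (H.equation _ hq), hp.radius_ray hl0, hRay, rayW]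

/-- Continuity is read off from the other side of the ray equation, so the terms of the source need
not be examined one by one. -/
theorem IsKGSolution.continuousOn_source (H : IsKGSolution c s₀ h f v₀ v₁ v) (hs₀ : 1 < s₀)
    {p : Spacetime} (hp : Timelike p) :
    ContinuousOn (fun l => source h f v (ray p l)) (Ici s₀) := by
  have : ContinuousOn (fun l => (1 + hRay h p l) * deriv (deriv (rayW v p)) l
      + c ^ 2 * rayW v p l) (Ici s₀) := fun l hl => by
    have hw := H.contDiffAt_rayW hs₀ hp hl
    have hw' : ContDiffAt ℝ 1 (deriv (rayW v p)) l := contDiffAt_deriv hw (by norm_num)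
    have hw'' : ContDiffAt ℝ 0 (deriv (deriv (rayW v p))) l := contDiffAt_deriv hw' (by norm_num)
    exact (((continuousAt_const.add (H.contDiffAt_hRay hs₀ hp hl).continuousAt).mul
      hw''.continuousAt).add (continuousAt_const.mul hw.continuousAt)).continuousWithinAt
  exact this.congr fun l hl => (H.rayW_equation hs₀ hp hl).symm

/-- The energy of the solution along the ray through `p`. -/
noncomputable def rayEnergy (c : ℝ) (h : Fin 4 → Fin 4 → Spacetime → ℝ) (v : Spacetime → ℝ)
    (p : Spacetime) (l : ℝ) : ℝ :=
  deriv (rayW v p) l ^ 2 + c ^ 2 * rayW v p l ^ 2 / (1 + hRay h p l)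

theorem IsKGSolution.sqrt_rayEnergy_le (H : IsKGSolution c s₀ h f v₀ v₁ v) (hs₀ : 1 < s₀)
    (hδ₀ : 0 < δ) (hδ₁ : δ < 1) (hδ : ∀ p ∈ future s₀, |hbar h 0 0 p| ≤ δ)
    {p : Spacetime} (hp : p ∈ future s₀) :
    √(rayEnergy c h v p (hypRadius p)) ≤ (1 / (1 - δ)) ^ 2 *
      (√(rayEnergy c h v p s₀) *
          (1 + ∫ σ in s₀..hypRadius p, rayWeight (1 / (1 - δ)) h p σ)
        + intSource s₀ h f v p (hypRadius p)
        + ∫ σ in s₀..hypRadius p, intSource s₀ h f v p σ * rayWeight (1 / (1 - δ)) h p σ) := by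
  have hpT := timelike_of_mem_future hs₀ hp
  refine sqrt_energy_le (w'' := deriv (deriv (rayW v p)))
    (G := fun l => source h f v (ray p l)) hδ₀ hδ₁ (le_radius_of_mem_future hp) ?_ ?_ ?_ ?_ ?_ ?_ ?_
  · exact fun l hl => ((H.contDiffAt_rayW hs₀ hpT hl.1).differentiableAt (by norm_num)).hasDerivAt
  · intro l hl
    have hw' : ContDiffAt ℝ 1 (deriv (rayW v p)) l :=
      contDiffAt_deriv (H.contDiffAt_rayW hs₀ hpT hl.1) (by norm_num)
    exact (hw'.differentiableAt (by norm_num)).hasDerivAt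
  · exact fun l hl => ((H.contDiffAt_hRay hs₀ hpT hl.1).differentiableAt (by norm_num)).hasDerivAt
  · exact fun l hl => hδ _ (ray_mem_future hs₀ hpT hl.1)
  · intro l hl
    have : ContDiffAt ℝ 0 (hRay' h p) l :=
      contDiffAt_deriv (H.contDiffAt_hRay hs₀ hpT hl.1) (by norm_num)
    exact this.continuousAt.continuousWithinAt
  · exact (H.continuousOn_source hs₀ hpT).mono Icc_subset_Ici_self
  · exact fun l hl => H.rayW_equation hs₀ hpT hl.1

/-- The left-hand side of the estimate is controlled by the energy along the ray. -/
theorem IsKGSolution.weighted_le_sqrt_rayEnergy (H : IsKGSolution c s₀ h f v₀ v₁ v)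
    (hc : 0 < c) (hs₀ : 1 < s₀) (hδ₁ : δ < 1) (hδ : ∀ p ∈ future s₀, |hbar h 0 0 p| ≤ δ)
    {p : Spacetime} (hp : p ∈ future s₀) :
    hypRadius p ^ (3 / 2 : ℝ) * |v p|
        + p.1 / hypRadius p * hypRadius p ^ (3 / 2 : ℝ) * |perp v p|
      ≤ (1 + 5 / c) * √(rayEnergy c h v p (hypRadius p)) := by
  have hpT := timelike_of_mem_future hs₀ hp
  have hs := le_radius_of_mem_future hp
  have hspos := hpT.radius_pos
  have hd := deriv_rayW hpT hspos (v := v) (by rw [hpT.ray_radius]; exact H.sol_smooth _ hp)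
  rw [hpT.ray_radius] at hd
  have hw : rayW v p (hypRadius p) = hypRadius p ^ (3 / 2 : ℝ) * v p := by
    rw [rayW, hpT.ray_radius]
  have hη : hRay h p (hypRadius p) = hbar h 0 0 p := by rw [hRay, hpT.ray_radius]
  have hηle := abs_le.1 (hδ p hp)
  set s := hypRadius p with hsdef
  have hk : s ^ (3 / 2 : ℝ) = s * s ^ (1 / 2 : ℝ) := by
    rw [show (3 / 2 : ℝ) = 1 + 1 / 2 by norm_num, Real.rpow_add hspos, Real.rpow_one]
  have hkpos : 0 < s ^ (1 / 2 : ℝ) := Real.rpow_pos_of_pos hspos _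
  have h32 : 0 < s ^ (3 / 2 : ℝ) := Real.rpow_pos_of_pos hspos _
  have hks : s ^ (1 / 2 : ℝ) ≤ s ^ (3 / 2 : ℝ) := by rw [hk]; nlinarith
  set E := rayEnergy c h v p s with hE
  set y := √E with hy
  have hy0 : 0 ≤ y := Real.sqrt_nonneg _
  have hden : 0 < 1 + hRay h p s := by rw [hη]; linarith
  -- The crude bound `4` is a perfect square, which gives `|w| ≤ (2/c) √E`.
  have hden2 : 1 + hRay h p s ≤ 4 := by rw [hη]; linarith
  have hE0 : 0 ≤ E := by rw [hE, rayEnergy]; positivity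
  have hysq : y ^ 2 = E := Real.sq_sqrt hE0
  have hD : |deriv (rayW v p) s| ≤ y := by
    refine abs_le_of_sq_le_sq ?_ hy0
    rw [hysq, hE, rayEnergy]
    have : 0 ≤ c ^ 2 * rayW v p s ^ 2 / (1 + hRay h p s) := by positivity
    linarith
  have hW : |rayW v p s| ≤ 2 / c * y := by
    refine abs_le_of_sq_le_sq ?_ (by positivity)
    have h1 : c ^ 2 * rayW v p s ^ 2 / 4 ≤ y ^ 2 := by
      rw [hysq, hE, rayEnergy]
      have : c ^ 2 * rayW v p s ^ 2 / 4 ≤ c ^ 2 * rayW v p s ^ 2 / (1 + hRay h p s) := by gcongr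
      nlinarith [sq_nonneg (deriv (rayW v p) s)]
    rw [mul_pow, div_pow, div_mul_eq_mul_div, le_div_iff₀ (by positivity)]
    linarith
  have hWabs : |rayW v p s| = s ^ (3 / 2 : ℝ) * |v p| := by rw [hw, abs_mul, abs_of_pos h32]
  have hperp : p.1 / s * s ^ (3 / 2 : ℝ) * |perp v p|
      = |deriv (rayW v p) s - 3 / 2 * s ^ (1 / 2 : ℝ) * v p| := by
    rw [hd, add_sub_cancel_left, ← time_div_radius_mul_perp hpT, abs_mul, abs_mul,
      abs_of_pos h32, abs_of_pos (div_pos hpT.1 hspos)]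
    ring
  -- As `s > 1`, the zeroth-order part of `w'` is absorbed by `(3/2) |w|`; in total `(5/2) (2/c) =
  -- 5/c`.
  have h3 : |3 / 2 * s ^ (1 / 2 : ℝ) * v p| ≤ 3 / 2 * |rayW v p s| := by
    rw [hWabs, abs_mul, abs_of_pos (by positivity : 0 < 3 / 2 * s ^ (1 / 2 : ℝ)), mul_assoc]
    gcongr
  rw [← hWabs, hperp]
  calc |rayW v p s| + |deriv (rayW v p) s - 3 / 2 * s ^ (1 / 2 : ℝ) * v p|
      ≤ |rayW v p s| + (|deriv (rayW v p) s| + |3 / 2 * s ^ (1 / 2 : ℝ) * v p|) := by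
        gcongr; exact abs_sub _ _
    _ ≤ 5 / 2 * (2 / c * y) + y := by linarith
    _ = (1 + 5 / c) * y := by ring

/-- The constant in the bound for the initial energy along a ray. -/
noncomputable def dataConst (c s₀ δ : ℝ) : ℝ :=
  s₀ ^ (3 / 2 : ℝ) * (c / (1 - δ)) + 3 / 2 * s₀ ^ (1 / 2 : ℝ) + s₀ ^ (3 / 2 : ℝ) * s₀

theorem ray_initial {p : Spacetime} (hs₀ : 1 < s₀) (hp : Timelike p) :
    ray p s₀ = hypPoint s₀ (ray p s₀).2 := by
  have hs0 : 0 < s₀ := by linarith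
  have := (hp.ray hs0).eq_hypPoint
  rwa [hp.radius_ray hs0] at this

theorem IsKGSolution.sqrt_rayEnergy_initial_le (H : IsKGSolution c s₀ h f v₀ v₁ v)
    (hc : 0 < c) (hs₀ : 1 < s₀) (hδ₀ : 0 < δ) (hδ₁ : δ < 1)
    (hδ : ∀ p ∈ future s₀, |hbar h 0 0 p| ≤ δ) {p : Spacetime} (hp : Timelike p) :
    √(rayEnergy c h v p s₀)
      ≤ dataConst c s₀ δ * (supNorm v₀ + supNorm v₁ + supNormGrad v₀) := by
  have hs0 : 0 < s₀ := by linarith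
  have hq := ray_mem_future hs₀ hp le_rfl
  have hηle := abs_le.1 (hδ _ hq)
  have hδ' : 0 < 1 - δ := by linarith
  have hd := deriv_rayW hp hs0 (H.sol_smooth _ hq)
  have hN0 : |v (ray p s₀)| ≤ supNorm v₀ := by
    rw [ray_initial hs₀ hp, H.data_zero]
    exact abs_le_supNorm (H.contDiff_data_zero hs₀).continuous H.hasCompactSupport.1 _
  have hN1 : |rayD v (ray p s₀)| ≤ supNorm v₁ + s₀ * supNormGrad v₀ := by
    rw [ray_initial hs₀ hp]
    exact H.abs_rayD_hypPoint_le hs₀ _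
  have h32 : 0 < s₀ ^ (3 / 2 : ℝ) := Real.rpow_pos_of_pos hs0 _
  have h12 : 0 < s₀ ^ (1 / 2 : ℝ) := Real.rpow_pos_of_pos hs0 _
  have hW : |rayW v p s₀| ≤ s₀ ^ (3 / 2 : ℝ) * supNorm v₀ := by
    rw [rayW, abs_mul, abs_of_pos h32]
    gcongr
  have hD : |deriv (rayW v p) s₀| ≤ 3 / 2 * s₀ ^ (1 / 2 : ℝ) * supNorm v₀
      + s₀ ^ (3 / 2 : ℝ) * (supNorm v₁ + s₀ * supNormGrad v₀) := by
    rw [hd]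
    refine (abs_add_le _ _).trans ?_
    rw [abs_mul, abs_mul _ (rayD _ _), abs_of_pos h32,
      abs_of_pos (by positivity : 0 < 3 / 2 * s₀ ^ (1 / 2 : ℝ))]
    gcongr
  have hE : √(rayEnergy c h v p s₀) ≤ |deriv (rayW v p) s₀| + c / (1 - δ) * |rayW v p s₀| := by
    refine Real.sqrt_le_iff.2 ⟨by positivity, ?_⟩
    have h1 : c ^ 2 * rayW v p s₀ ^ 2 / (1 + hRay h p s₀)
        ≤ c ^ 2 * rayW v p s₀ ^ 2 / (1 - δ) ^ 2 := by
      -- Weakening `1 - δ` to its square leaves `c / (1 - δ)` after the root.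
      have : (1 - δ) ^ 2 ≤ 1 + hRay h p s₀ := by
        rw [hRay]
        nlinarith
      gcongr
    have h2 : (c / (1 - δ) * |rayW v p s₀|) ^ 2 = c ^ 2 * rayW v p s₀ ^ 2 / (1 - δ) ^ 2 := by
      rw [mul_pow, sq_abs, div_pow]
      ring
    have h3 : 0 ≤ |deriv (rayW v p) s₀| * (c / (1 - δ) * |rayW v p s₀|) := by positivity
    rw [rayEnergy, add_sq, sq_abs, h2]
    linarith
  have n0 := supNorm_nonneg v₀
  have n1 := supNorm_nonneg v₁
  have n2 := supNormGrad_nonneg v₀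
  refine hE.trans ?_
  have h4 : c / (1 - δ) * |rayW v p s₀| ≤ c / (1 - δ) * (s₀ ^ (3 / 2 : ℝ) * supNorm v₀) := by
    gcongr
  have h5 : s₀ ^ (3 / 2 : ℝ) * supNorm v₁ ≤ s₀ ^ (3 / 2 : ℝ) * s₀ * supNorm v₁ := by
    gcongr
    nlinarith
  have h6 : 0 ≤ c / (1 - δ) * (s₀ ^ (3 / 2 : ℝ) * (supNorm v₁ + supNormGrad v₀)) := by positivity
  have h7 : 0 ≤ 3 / 2 * s₀ ^ (1 / 2 : ℝ) * (supNorm v₁ + supNormGrad v₀) := by positivity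
  have h8 : 0 ≤ s₀ ^ (3 / 2 : ℝ) * s₀ * supNorm v₀ := by positivity
  rw [dataConst]
  linarith

/-- Outside `K` the functions `v₀`, `v₁` and the gradient of `v₀` vanish, so `w` and `w'` both start
from zero. -/
theorem IsKGSolution.rayEnergy_initial_eq_zero (H : IsKGSolution c s₀ h f v₀ v₁ v)
    (hs₀ : 1 < s₀) {p : Spacetime} (hp : Timelike p) (hK : ray p s₀ ∉ coneK) :
    rayEnergy c h v p s₀ = 0 := by
  have hs0 : 0 < s₀ := by linarith
  have hd := deriv_rayW hp hs0 (H.sol_smooth _ (ray_mem_future hs₀ hp le_rfl))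
  have hq := ray_initial hs₀ hp
  rw [hq] at hK
  have hv : v (ray p s₀) = 0 := by
    rw [hq, H.data_zero]
    exact (H.data_supp _ hK).1
  have hD : rayD v (ray p s₀) = 0 := by
    rw [hq, H.rayD_hypPoint hs₀, (H.data_supp _ hK).2, H.fderiv_data_eq_zero hK]
    simp
  rw [rayEnergy, hd, rayW, hv, hD]
  simp

/-- Before the ray enters the cone `K`, either the metric or the solution is trivial. -/
theorem IsKGSolution.intSource_mul_rayWeight_eq_zero (H : IsKGSolution c s₀ h f v₀ v₁ v)
    (hs₀ : 1 < s₀) {C : ℝ}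
    (hout : (∀ p ∈ future s₀, p ∉ coneK → ∀ α β, h α β p = 0) ∨
      (∀ p ∈ future s₀, p ∉ coneK → v p = 0))
    {p : Spacetime} (hp : Timelike p) {σ : ℝ} (hσ : σ ∈ Ioo s₀ (entryRadius p)) :
    intSource s₀ h f v p σ * rayWeight C h p σ = 0 := by
  have hs0 : 0 < s₀ := by linarith
  have hmem : ∀ l ∈ Ioo s₀ (entryRadius p), ray p l ∈ future s₀ ∧ ray p l ∉ coneK := fun l hl =>
    ⟨ray_mem_future hs₀ hp hl.1.le, ray_notMem_coneK hp (hs0.trans hl.1) hl.2⟩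
  have hnhds : ∀ l ∈ Ioo s₀ (entryRadius p), Ioo s₀ (entryRadius p) ∈ 𝓝 l := fun l hl =>
    isOpen_Ioo.mem_nhds hl
  rcases hout with hflat | hzero
  · have : hRay h p =ᶠ[𝓝 σ] fun _ => 0 := by
      filter_upwards [hnhds σ hσ] with l hl
      simp [hRay, hbar, hflat _ (hmem l hl).1 (hmem l hl).2]
    have h0 : hRay' h p σ = 0 := by
      rw [hRay', this.deriv_eq]
      simp
    simp [rayWeight, h0]
  · have hw : ∀ l ∈ Ioo s₀ (entryRadius p), rayW v p l = 0 := fun l hl => by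
      simp [rayW, hzero _ (hmem l hl).1 (hmem l hl).2]
    have hw' : ∀ l ∈ Ioo s₀ (entryRadius p), deriv (rayW v p) l = 0 := fun l hl => by
      have : rayW v p =ᶠ[𝓝 l] fun _ => 0 := by filter_upwards [hnhds l hl] using hw
      rw [this.deriv_eq]
      simp
    have hw'' : ∀ l ∈ Ioo s₀ (entryRadius p), deriv (deriv (rayW v p)) l = 0 := fun l hl => by
      have : deriv (rayW v p) =ᶠ[𝓝 l] fun _ => 0 := by filter_upwards [hnhds l hl] using hw'
      rw [this.deriv_eq]
      simp
    -- No assumption on `f` is needed here: the ray equation with `w = w'' = 0` forces the source to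
    -- vanish.
    have : intSource s₀ h f v p σ = 0 := by
      refine intervalIntegral.integral_zero_ae (Eventually.of_forall fun l hl => ?_)
      rw [uIoc_of_le hσ.1.le] at hl
      have hl' : l ∈ Ioo s₀ (entryRadius p) := ⟨hl.1, hl.2.trans_lt hσ.2⟩
      have := H.rayW_equation hs₀ hp hl.1.le
      rw [hw l hl', hw'' l hl'] at this
      simp only [source] at this
      rw [← this]
      simp
    rw [this, zero_mul]

theorem intSource_nonneg {p : Spacetime} {τ : ℝ} (hτ : s₀ ≤ τ) : 0 ≤ intSource s₀ h f v p τ :=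
  intervalIntegral.integral_nonneg hτ fun _ _ => abs_nonneg _

theorem rayWeight_nonneg (C : ℝ) (p : Spacetime) (σ : ℝ) : 0 ≤ rayWeight C h p σ := by
  rw [rayWeight]
  positivity

theorem integral_rayWeight_nonneg (C : ℝ) {p : Spacetime} (hp : p ∈ future s₀) :
    0 ≤ ∫ σ in s₀..hypRadius p, rayWeight C h p σ :=
  intervalIntegral.integral_nonneg (le_radius_of_mem_future hp) fun _ _ => rayWeight_nonneg C p _

theorem integral_intSource_mul_rayWeight_nonneg (C : ℝ) {p : Spacetime} (hp : p ∈ future s₀) :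
    0 ≤ ∫ σ in s₀..hypRadius p, intSource s₀ h f v p σ * rayWeight C h p σ :=
  intervalIntegral.integral_nonneg (le_radius_of_mem_future hp) fun _ hσ =>
    mul_nonneg (intSource_nonneg hσ.1) (rayWeight_nonneg C p _)

/-- The source terms of `boundV` can be integrated from `s₀` in both cases. -/
theorem IsKGSolution.boundV_eq (H : IsKGSolution c s₀ h f v₀ v₁ v) (hs₀ : 1 < s₀) (C D : ℝ)
    (hout : (∀ p ∈ future s₀, p ∉ coneK → ∀ α β, h α β p = 0) ∨
      (∀ p ∈ future s₀, p ∉ coneK → v p = 0))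
    {p : Spacetime} (hp : p ∈ future s₀) :
    boundV C s₀ D h f v p
      = (if ‖p.2‖ / p.1 ≤ (s₀ ^ 2 - 1) / (1 + s₀ ^ 2) then D else 0)
          * (1 + ∫ σ in s₀..hypRadius p, rayWeight C h p σ)
        + intSource s₀ h f v p (hypRadius p)
        + ∫ σ in s₀..hypRadius p, intSource s₀ h f v p σ * rayWeight C h p σ := by
  have hpT := timelike_of_mem_future hs₀ hp
  rw [boundV]
  split_ifs with hfar
  · rfl
  · rw [zero_mul, zero_add, ← integral_eq_of_eq_zero_on_Ioo (le_radius_of_mem_future hp)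
      (lt_entryRadius hs₀ hpT (not_le.1 hfar)).le
      fun σ hσ => H.intSource_mul_rayWeight_eq_zero hs₀ hout hpT hσ]

/-- The bound is affine in the data size, with nonnegative coefficients; `B ≥ 1` takes care of the
terms free of data. This trades the full data norm for the one without gradient. -/
theorem IsKGSolution.boundV_le_mul (H : IsKGSolution c s₀ h f v₀ v₁ v) (hs₀ : 1 < s₀)
    {C D D' B : ℝ} (hB : 1 ≤ B) (hD : D' ≤ B * D)
    (hout : (∀ p ∈ future s₀, p ∉ coneK → ∀ α β, h α β p = 0) ∨
      (∀ p ∈ future s₀, p ∉ coneK → v p = 0))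
    {p : Spacetime} (hp : p ∈ future s₀) :
    boundV C s₀ D' h f v p ≤ B * boundV C s₀ D h f v p := by
  rw [H.boundV_eq hs₀ C D' hout hp, H.boundV_eq hs₀ C D hout hp]
  have hI := integral_rayWeight_nonneg (h := h) C hp
  have hJ := integral_intSource_mul_rayWeight_nonneg (h := h) (f := f) (v := v) C hp
  have hF := intSource_nonneg (h := h) (f := f) (v := v) (p := p) (le_radius_of_mem_future hp)
  rw [mul_add B, mul_add B, ← mul_assoc]
  gcongr ?_ * _ + ?_ + ?_
  · split_ifs
    · exact hD
    · simp
  · exact le_mul_of_one_le_left hF hB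
  · exact le_mul_of_one_le_left hJ hB

theorem dataConst_nonneg (hc : 0 < c) (hs₀ : 1 < s₀) (hδ₁ : δ < 1) : 0 ≤ dataConst c s₀ δ := by
  have : 0 < 1 - δ := by linarith
  rw [dataConst]
  positivity

/-- The estimate in terms of the full data norm, with an explicit constant. -/
theorem IsKGSolution.weighted_le_boundV (H : IsKGSolution c s₀ h f v₀ v₁ v)
    (hc : 0 < c) (hs₀ : 1 < s₀) (hδ₀ : 0 < δ) (hδ₁ : δ < 1)
    (hδ : ∀ p ∈ future s₀, |hbar h 0 0 p| ≤ δ)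
    (hout : (∀ p ∈ future s₀, p ∉ coneK → ∀ α β, h α β p = 0) ∨
      (∀ p ∈ future s₀, p ∉ coneK → v p = 0))
    {p : Spacetime} (hp : p ∈ future s₀) :
    hypRadius p ^ (3 / 2 : ℝ) * |v p|
        + p.1 / hypRadius p * hypRadius p ^ (3 / 2 : ℝ) * |perp v p|
      ≤ (1 + 5 / c) * (1 / (1 - δ)) ^ 2 * (1 + dataConst c s₀ δ)
        * boundV (1 / (1 - δ)) s₀ (supNorm v₀ + supNorm v₁ + supNormGrad v₀) h f v p := by
  have hpT := timelike_of_mem_future hs₀ hp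
  have hB := dataConst_nonneg hc hs₀ hδ₁
  refine (H.weighted_le_sqrt_rayEnergy hc hs₀ hδ₁ hδ hp).trans ?_
  rw [mul_assoc, mul_assoc]
  refine mul_le_mul_of_nonneg_left ((H.sqrt_rayEnergy_le hs₀ hδ₀ hδ₁ hδ hp).trans ?_) (by positivity)
  refine mul_le_mul_of_nonneg_left ?_ (by positivity)
  rw [H.boundV_eq hs₀ _ _ hout hp]
  have hI := integral_rayWeight_nonneg (h := h) (1 / (1 - δ)) hp
  have hJ := integral_intSource_mul_rayWeight_nonneg (h := h) (f := f) (v := v) (1 / (1 - δ)) hp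
  have hF := intSource_nonneg (h := h) (f := f) (v := v) (p := p) (le_radius_of_mem_future hp)
  -- The summand `1` in the constant makes it at least `1`, as the source terms require.
  rw [mul_add (1 + dataConst c s₀ δ), mul_add (1 + dataConst c s₀ δ), ← mul_assoc]
  gcongr ?_ * _ + ?_ + ?_
  · split_ifs with hfar
    · refine (H.sqrt_rayEnergy_initial_le hc hs₀ hδ₀ hδ₁ hδ hpT).trans ?_
      have := supNorm_nonneg v₀
      have := supNorm_nonneg v₁
      have := supNormGrad_nonneg v₀
      gcongr
      linarith
    · have hent := lt_entryRadius hs₀ hpT (not_le.1 hfar)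
      rw [H.rayEnergy_initial_eq_zero hs₀ hpT (ray_notMem_coneK hpT (by linarith) hent)]
      simp
  · exact le_mul_of_one_le_left hF (by linarith)
  · exact le_mul_of_one_le_left hJ (by linarith)

/-- This settles the degenerate case in which the ratio of the gradient norm to the data norm is no
bound. -/
theorem IsKGSolution.supNormGrad_eq_zero (H : IsKGSolution c s₀ h f v₀ v₁ v) (hs₀ : 1 < s₀)
    (h0 : supNorm v₀ = 0) : supNormGrad v₀ = 0 := by
  have : v₀ = fun _ => 0 := funext fun x => by
    have := abs_le_supNorm (H.contDiff_data_zero hs₀).continuous H.hasCompactSupport.1 x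
    rw [h0] at this
    simpa using this
  rw [this, supNormGrad]
  simp

end Solution

end HypKG

end

/-! ### Choice of the constants. -/

theorem proposition44 (c s₀ δ : ℝ) (hc : 0 < c) (hs₀ : 1 < s₀) (hδ₀ : 0 < δ) (hδ₁ : δ < 1) :
    -- the constants `C` and `A` depend on `c, s₀, δ` only
    ∃ C > 0, ∃ A > 0, ∀ v₀ v₁ : HypKG.Space → ℝ,
      -- the constant `A'` depends on `c, s₀, δ` and on the data only
      ∃ A' > 0,
        ∀ (h : Fin 4 → Fin 4 → HypKG.Spacetime → ℝ) (f v : HypKG.Spacetime → ℝ),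
          HypKG.IsKGSolution c s₀ h f v₀ v₁ v →
          -- the metric is a perturbation of the Minkowski metric
          (∀ p ∈ HypKG.future s₀, |HypKG.hbar h 0 0 p| ≤ δ) →
          -- outside the light cone, the metric is flat or the solution vanishes
          ((∀ p ∈ HypKG.future s₀, p ∉ HypKG.coneK → ∀ α β, h α β p = 0) ∨
            (∀ p ∈ HypKG.future s₀, p ∉ HypKG.coneK → v p = 0)) →
          ∀ p ∈ HypKG.future s₀,
            (HypKG.hypRadius p ^ (3 / 2 : ℝ) * |v p|
                + p.1 / HypKG.hypRadius p * HypKG.hypRadius p ^ (3 / 2 : ℝ) * |HypKG.perp v p|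
              ≤ A' * HypKG.boundV C s₀ (HypKG.supNorm v₀ + HypKG.supNorm v₁) h f v p) ∧
            (HypKG.hypRadius p ^ (3 / 2 : ℝ) * |v p|
                + p.1 / HypKG.hypRadius p * HypKG.hypRadius p ^ (3 / 2 : ℝ) * |HypKG.perp v p|
              ≤ A * HypKG.boundV C s₀
                  (HypKG.supNorm v₀ + HypKG.supNorm v₁ + HypKG.supNormGrad v₀) h f v p) := by
  have hδ' : 0 < 1 - δ := by linarith
  have hB := HypKG.dataConst_nonneg hc hs₀ hδ₁
  set A : ℝ := (1 + 5 / c) * (1 / (1 - δ)) ^ 2 * (1 + HypKG.dataConst c s₀ δ) with hA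
  have hApos : 0 < A := by positivity
  refine ⟨1 / (1 - δ), by positivity, A, hApos, fun v₀ v₁ => ?_⟩
  have n0 := HypKG.supNorm_nonneg v₀
  have n1 := HypKG.supNorm_nonneg v₁
  have n2 := HypKG.supNormGrad_nonneg v₀
  set D := HypKG.supNorm v₀ + HypKG.supNorm v₁ with hD
  -- The factor is chosen so that its product with `D` is `D` plus the gradient norm when `D > 0`.
  -- If `D = 0`, the quotient is `0` by convention, and the gradient norm vanishes too for the data
  -- of a solution.
  refine ⟨A * (1 + HypKG.supNormGrad v₀ / D), by positivity, fun h f v H hδ hout p hp => ?_⟩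
  have hmain := H.weighted_le_boundV hc hs₀ hδ₀ hδ₁ hδ hout hp
  refine ⟨hmain.trans ?_, hmain⟩
  rw [mul_assoc A]
  refine mul_le_mul_of_nonneg_left (H.boundV_le_mul hs₀ ?_ ?_ hout hp) hApos.le
  · have : 0 ≤ HypKG.supNormGrad v₀ / D := by positivity
    linarith
  · rcases (by positivity : 0 ≤ D).eq_or_lt' with h0 | hpos
    · rw [← hD, h0, H.supNormGrad_eq_zero hs₀ (by linarith)]
      simp
    · rw [add_mul, div_mul_cancel₀ _ hpos.ne', one_mul]
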